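/- Let $K$ be a field, $c\ge 1$ an integer, and $R_n=K[x_{k,j}\mid 1\le k\le c,\ 1\le j\le n]$ for $n\ge 1$, with the standard grading. For a nonzero finitely generated graded $R_n$-module $M$ let $\operatorname{reg}(M)=\max\{j-p\mid \operatorname{Tor}_p^{R_n}(K,M)_j\neq 0\}$ be its Castelnuovo–Mumford regularity. For $i\ge 0$ let $\mathrm{Inc}(\mathbb N)^i$ be the monoid of strictly increasing maps $\pi:\mathbb{Z}_{\ge 1}\to\mathbb{Z}_{\ge 1}$ with $\pi(j)=j$ for all $j\le i$, and for $m\le n$ let $\mathrm{Inc}(\mathbb N)^i_{m,n}=\{\pi\in\mathrm{Inc}(\mathbb N)^i\mid \pi(m)\le n\}$; each such $\pi$ acts as $R_m\to R_n$, $x_{k,j}\mapsto x_{k,\pi(j)}$. A sequence $\mathcal I=(I_n)_{n\ge 1}$ of ideals $I_n\subseteq R_n$ is an $\mathrm{Inc}(\mathbb N)^i$-invariant chain if $\mathrm{Inc}(\mathbb N)^i_{m,n}(I_m)\subseteq I_n$ for all $m\le n$. Its stability index $\operatorname{ind}^i(\mathcal I)$ is the least $r\ge 1$ such that $I_n=\langle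 \mathrm{Inc}(\mathbb N)^i_{m,n}(I_m)\rangle_{R_n}$ for all $n\ge m\ge r$ (such an $r$ always exists). Let $\mathcal F$ be the family of all pairs $(i,\mathcal I)$ where $i\ge 0$ is an integer and $\mathcal I=(I_n)_{n\ge1}$ is an $\mathrm{Inc}(\mathbb N)^i$-invariant chain of monomial ideals, not all of them zero. For $(i,\mathcal I)\in\mathcal F$ with $r=\operatorname{ind}^i(\mathcal I)$ and $\mathbf e=(e_1,\dots,e_c)\in\mathbb Z_{\ge0}^c$, let $|\mathbf e|=e_1+\cdots+e_c$ and let $\mathcal I_{\mathbf e}=(I_{\mathbf e,n})_{n\ge1}$ be the chain with $$I_{\mathbf e,n}=\langle I_n:x_{1,i+1}^{e_1}\cdots x_{c,i+1}^{e_c},\ x_{1,i+1},\dots,x_{c,i+1}\rangle\quad\text{if } n\ge \max\{r,i\}+1,$$ and $I_{\mathbf e,n}=0$ if $n\le\max\{r,i\}$. A subfamily $\mathcal E\subseteq\mathcal F$ is called extremal if for every $(i,\mathcal I)\in\mathcal E$ there is a subset $E(\mathcal I)\subseteq\mathbb Z_{\ge 0}^c$ such that (X1) $(i+1,\mathcal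 I_{\mathbf e})\in\mathcal E$ for all $\mathbf e\in E(\mathcal I)$, and (X2) $\operatorname{reg}(I_n)=\max\{\operatorname{reg}(I_{\mathbf e,n})+|\mathbf e|\mid \mathbf e\in E(\mathcal I)\}$ for all $n\gg0$ (in particular, this maximum exists). **Theorem.** Let $\mathcal E$ be an extremal subfamily of $\mathcal F$. Then for every $(i,\mathcal I)\in\mathcal E$ with $\mathcal I=(I_n)_{n\ge 1}$ there exist integers $\mathcal C(\mathcal I)$ and $\mathcal D(\mathcal I)$ such that $$\operatorname{reg}(I_n)=\mathcal C(\mathcal I)\,n+\mathcal D(\mathcal I)\quad\text{for all } n\gg0.$$ -/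

import Mathlib

open MvPolynomial

/-! ## Castelnuovo–Mumford regularity

Let `S = K[x_s | s ∈ σ]` with `σ` finite, and let `M` be a graded `S`-module with graded pieces
`ℳ j`, `j ∈ ℤ`. The Koszul complex on the variables is a graded free resolution of `K = S/(x_s)`,
so `Tor^S_p(K, M)` is the `p`-th homology of the complex `⋀^p(K^σ) ⊗_K M`, where the basis vectors
of `⋀^p(K^σ)` have degree `p`. An element of `⋀^p(K^σ) ⊗_K M` is written as the alternating
`p`-linear map of its coefficients. -/

section Regularity

variable (σ K : Type*) [Fintype σ] [DecidableEq σ] [Field K]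
variable (M : Type*) [AddCommGroup M] [Module (MvPolynomial σ K) M] [Module K M]
  [IsScalarTower K (MvPolynomial σ K) M]

/-- The Koszul differential `⋀^{p+1}(K^σ) ⊗ M → ⋀^p(K^σ) ⊗ M`: the contraction with
`∑ x_s e_s`, i.e. `(∂f)(v₁, …, v_p) = ∑ₛ x_s · f(e_s, v₁, …, v_p)`. -/
noncomputable def koszulD (p : ℕ) :
    ((σ → K) [⋀^Fin (p + 1)]→ₗ[K] M) →ₗ[K] ((σ → K) [⋀^Fin p]→ₗ[K] M) where
  toFun f := ∑ s : σ, (Algebra.lsmul K K M (X s : MvPolynomial σ K)).compAlternatingMap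
    (f.curryLeft (Pi.single s 1))
  map_add' f g := by
    rw [← Finset.sum_add_distrib]
    refine Finset.sum_congr rfl fun s _ => ?_
    ext v
    simp
  map_smul' a f := by
    rw [Finset.smul_sum]
    refine Finset.sum_congr rfl fun s _ => ?_
    ext v
    exact smul_comm (X s : MvPolynomial σ K) a _

/-- The Koszul cycles in homological degree `p`. -/
noncomputable def koszulCycles : (p : ℕ) → Submodule K ((σ → K) [⋀^Fin p]→ₗ[K] M)
  | 0 => ⊤
  | p + 1 => LinearMap.ker (koszulD σ K M p)

variable {K M}

/-- The piece of internal degree `j` of `⋀^p(K^σ) ⊗ M`: all coefficients lie in `ℳ (j - p)`. -/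
def koszulPiece (ℳ : ℤ → Submodule K M) (p : ℕ) (j : ℤ) :
    Submodule K ((σ → K) [⋀^Fin p]→ₗ[K] M) where
  carrier := {f | ∀ v, f v ∈ ℳ (j - p)}
  add_mem' hf hg v := by simpa using (ℳ (j - p)).add_mem (hf v) (hg v)
  zero_mem' v := by simp
  smul_mem' a f hf v := by simpa using (ℳ (j - p)).smul_mem a (hf v)

/-- The graded piece `Tor^S_p(K, M)_j`: cycles of internal degree `j` modulo boundaries of
chains of internal degree `j`. -/
abbrev GradedTor (ℳ : ℤ → Submodule K M) (p : ℕ) (j : ℤ) : Type _ :=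
  ↥(koszulCycles σ K M p ⊓ koszulPiece σ ℳ p j) ⧸
    ((koszulPiece σ ℳ (p + 1) j).map (koszulD σ K M p)).submoduleOf
      (koszulCycles σ K M p ⊓ koszulPiece σ ℳ p j)

/-- `reg M = max {j - p | Tor_p(K, M)_j ≠ 0}`. (For a nonzero finitely generated graded module
this set of integers is nonempty and bounded above, so the supremum is a maximum.) -/
noncomputable def gradedReg (ℳ : ℤ → Submodule K M) : ℤ :=
  sSup {m | ∃ (p : ℕ) (j : ℤ), Nontrivial (GradedTor σ ℳ p j) ∧ m = j - p}

variable {σ}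

/-- The standard grading on an ideal `J` of a polynomial ring: degree `j` consists of the elements
of `J` all of whose monomials have degree `j`. -/
def Ideal.stdGrading (J : Ideal (MvPolynomial σ K)) (j : ℤ) : Submodule K J where
  carrier := {f | ∀ m : σ →₀ ℕ, (f : MvPolynomial σ K).coeff m ≠ 0 → (m.degree : ℤ) = j}
  add_mem' {f g} hf hg m hm := by
    by_cases h : (f : MvPolynomial σ K).coeff m = 0
    · exact hg m fun h' => hm (by simp [h, h'])
    · exact hf m h
  zero_mem' m hm := absurd (by simp) hm
  smul_mem' a f hf m hm := hf m fun h => hm (by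
    rw [Submodule.coe_smul_of_tower, coeff_smul, h, smul_zero])

/-- The Castelnuovo–Mumford regularity of a graded ideal, as a graded module. -/
noncomputable def Ideal.reg (J : Ideal (MvPolynomial σ K)) : ℤ := gradedReg σ J.stdGrading

/-- A monomial ideal: an ideal generated by monomials. -/
def Ideal.IsMonomialIdeal (J : Ideal (MvPolynomial σ K)) : Prop :=
  ∃ A : Set (σ →₀ ℕ), J = Ideal.span ((fun a => monomial a (1 : K)) '' A)

end Regularity

/-! ## Invariant chains

`R_n = K[x_{k,j} | k ∈ [c], j ∈ [n]]`. Rows and columns are numbered from `0`, so the variable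
`x_{k,j}` (with `1 ≤ j ≤ n`) is `X (k - 1, j - 1)`, and a function `π` on the positive integers
becomes the function `j ↦ π (j + 1) - 1` on `ℕ`. -/

namespace IncChain

/-- The polynomial ring `R_n` in `c × n` variables. -/
abbrev PolyRing (K : Type*) [Field K] (c n : ℕ) : Type _ := MvPolynomial (Fin c × Fin n) K

/-- A sequence `(I_n)_{n ≥ 1}` of ideals `I_n ⊆ R_n`. -/
abbrev Chain (K : Type*) [Field K] (c : ℕ) : Type _ := (n : ℕ+) → Ideal (PolyRing K c n)

/-- The monoid `Inc(ℕ)^i` of strictly increasing functions fixing the first `i` numbers. -/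
def Inc (i : ℕ) : Set (ℕ → ℕ) := {π | StrictMono π ∧ ∀ j < i, π j = j}

variable {K : Type*} [Field K] {c : ℕ}

/-- For `π` mapping the first `m` columns into the first `n` columns, the action
`x_{k,j} ↦ x_{k,π(j)}` of `π` as a map `R_m → R_n`. -/
noncomputable def act {m n : ℕ} (π : ℕ → ℕ) (h : ∀ j : Fin m, π j < n) :
    PolyRing K c m →ₐ[K] PolyRing K c n :=
  rename fun x => (x.1, ⟨π x.2, h x.2⟩)

/-- The set `Inc(ℕ)^i_{m,n}(I_m) ⊆ R_n`. -/
def orbit (i : ℕ) (I : Chain K c) (m n : ℕ+) : Set (PolyRing K c n) :=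
  {g | ∃ π ∈ Inc i, ∃ h : ∀ j : Fin m, π j < n, ∃ f ∈ I m, g = act π h f}

/-- `Inc(ℕ)^i`-invariance of a chain. -/
def IsInvariant (i : ℕ) (I : Chain K c) : Prop :=
  ∀ m n : ℕ+, m ≤ n → orbit i I m n ⊆ I n

/-- The `i`-stability index `ind^i(I)`: the least `r ≥ 1` such that
`I_n = ⟨Inc(ℕ)^i_{m,n}(I_m)⟩` for all `n ≥ m ≥ r`. -/
noncomputable def ind (i : ℕ) (I : Chain K c) : ℕ :=
  sInf {r | 1 ≤ r ∧ ∀ m n : ℕ+, r ≤ m → m ≤ n → I n = Ideal.span (orbit i I m n)}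

/-- The chain `I_e`: with `r = ind^i(I)`, its `n`-th ideal is
`⟨I_n : x_{1,i+1}^{e_1} ⋯ x_{c,i+1}^{e_c}, x_{1,i+1}, …, x_{c,i+1}⟩` for `n > r`, and `0` for
`n ≤ r`. (It is also `0` if `n ≤ i`, when the variables `x_{k,i+1}` do not belong to `R_n`.) -/
noncomputable def colonChain (i : ℕ) (I : Chain K c) (e : Fin c → ℕ) : Chain K c := fun n =>
  if h : ind i I < n ∧ i < n then
    (I n).colon {∏ k : Fin c, X (k, ⟨i, h.2⟩) ^ e k} ⊔
      Ideal.span (Set.range fun k : Fin c => X (k, ⟨i, h.2⟩))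
  else ⊥

/-- The family `𝓕` of all pairs `(i, I)` with `I` a nonzero `Inc(ℕ)^i`-invariant chain of
monomial ideals. -/
def family (K : Type*) [Field K] (c : ℕ) : Set (ℕ × Chain K c) :=
  {p | (∃ n, p.2 n ≠ ⊥) ∧ (∀ n, (p.2 n).IsMonomialIdeal) ∧ IsInvariant p.1 p.2}

/-- Extremal subfamilies of `𝓕`. -/
def IsExtremal (𝓔 : Set (ℕ × Chain K c)) : Prop :=
  𝓔 ⊆ family K c ∧
  ∀ (i : ℕ) (I : Chain K c), (i, I) ∈ 𝓔 → ∃ E : Set (Fin c → ℕ),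
    (∀ e ∈ E, (i + 1, colonChain i I e) ∈ 𝓔) ∧
    ∀ᶠ n : ℕ+ in Filter.atTop,
      IsGreatest ((fun e => (colonChain i I e n).reg + ∑ k, (e k : ℤ)) '' E) (I n).reg

end IncChain

/-!
The Koszul homology of an ideal only changes in a controlled way when a variable is adjoined to
both the ring and the ideal, so adjoining a whole column of variables does not change the
regularity of a nonzero ideal.

Encode the monomials of a chain as words over `ℕ^c`. Divisibility up to the action of `Inc(ℕ)^i`
is then a well-quasi-order by Higman's lemma, so upper sets of words cannot grow forever, even up
to words of bounded length. Passing from `I` to `I_e` does not shrink the upper set of the chain.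
If it grows, then `reg I_{e,n}` is eventually linear by induction. If not, then `I_{e,n+1}` is
eventually `I_n` with a column of variables adjoined, so `reg I_{e,n+1} = reg I_n`. Hence
`reg I_{n+1} = max (L (n + 1)) (reg I_n + a)` for an eventually linear `L` and a constant `a`, and
such a sequence is eventually linear.
-/

namespace Koszul

section Alternating

variable {R V W M N : Type*} [CommRing R] [AddCommGroup V] [Module R V] [AddCommGroup W]
  [Module R W] [AddCommGroup M] [Module R M] [AddCommGroup N] [Module R N]

/-- The exterior product `g ↦ ε ∧ g` of alternating maps by a linear form `ε`. -/
def wedge (ε : V →ₗ[R] R) (p : ℕ) : (V [⋀^Fin p]→ₗ[R] M) →ₗ[R] (V [⋀^Fin (p + 1)]→ₗ[R] M) where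
  toFun g := AlternatingMap.alternatizeUncurryFin (ε.smulRight g)
  map_add' f g := by
    rw [← AlternatingMap.alternatizeUncurryFin_add]
    congr 1
    ext
    simp
  map_smul' a g := by
    rw [RingHom.id_apply, ← AlternatingMap.alternatizeUncurryFin_smul]
    congr 1
    ext
    simp [smul_comm a]

lemma wedge_apply (ε : V →ₗ[R] R) {p : ℕ} (g : V [⋀^Fin p]→ₗ[R] M) (v : Fin (p + 1) → V) :
    wedge ε p g v = ∑ i : Fin (p + 1), (-1) ^ (i : ℕ) • ε (v i) • g (i.removeNth v) := by
  simp [wedge, AlternatingMap.alternatizeUncurryFin_apply]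

lemma wedge_apply_mem (ε : V →ₗ[R] R) {p : ℕ} {g : V [⋀^Fin p]→ₗ[R] M} {P : Submodule R M}
    (hg : ∀ v, g v ∈ P) (v : Fin (p + 1) → V) : wedge ε p g v ∈ P := by
  rw [wedge_apply]
  exact P.sum_mem fun i _ => zsmul_mem (P.smul_mem _ (hg _)) ((-1) ^ (i : ℕ))

lemma curryLeft_wedge_zero (ε : V →ₗ[R] R) (g : V [⋀^Fin 0]→ₗ[R] M) (x : V) :
    (wedge ε 0 g).curryLeft x = ε x • g := by
  ext v
  rw [AlternatingMap.curryLeft_apply_apply, wedge_apply]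
  simp [Subsingleton.elim (Fin.removeNth 0 (Matrix.vecCons x v)) v]

lemma curryLeft_wedge (ε : V →ₗ[R] R) {p : ℕ} (g : V [⋀^Fin (p + 1)]→ₗ[R] M) (x : V) :
    (wedge ε (p + 1) g).curryLeft x = ε x • g - wedge ε p (g.curryLeft x) := by
  have removeNth_succ (v : Fin (p + 1) → V) (i : Fin (p + 1)) :
      i.succ.removeNth (Matrix.vecCons x v) = Matrix.vecCons x (i.removeNth v) := by
    ext j
    cases j using Fin.cases <;> simp [Fin.removeNth]
  ext v
  rw [AlternatingMap.sub_apply, AlternatingMap.curryLeft_apply_apply, wedge_apply, wedge_apply,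
    Fin.sum_univ_succ, sub_eq_add_neg, ← Finset.sum_neg_distrib]
  simp [removeNth_succ, pow_succ]

lemma curryLeft_curryLeft_comm {p : ℕ} (g : V [⋀^Fin (p + 2)]→ₗ[R] M) (x y : V) :
    (g.curryLeft x).curryLeft y = -(g.curryLeft y).curryLeft x := by
  have h := AlternatingMap.curryLeft_same g (x + y)
  simp only [map_add, AlternatingMap.curryLeft_add, LinearMap.add_apply,
    AlternatingMap.curryLeft_same, zero_add, add_zero] at h
  rwa [eq_neg_iff_add_eq_zero, add_comm]

lemma ext_curryLeft {p : ℕ} {f g : V [⋀^Fin (p + 1)]→ₗ[R] M}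
    (h : ∀ x, f.curryLeft x = g.curryLeft x) : f = g := by
  ext v
  rw [← Matrix.cons_head_tail v]
  exact congr($(h _) _)

lemma compLinearMap_of_isEmpty (u : V →ₗ[R] V) (f : V [⋀^Fin 0]→ₗ[R] M) :
    f.compLinearMap u = f := by
  ext v
  exact congrArg f (Subsingleton.elim _ _)

lemma curryLeft_sub {p : ℕ} (f g : V [⋀^Fin (p + 1)]→ₗ[R] M) (x : V) :
    (f - g).curryLeft x = f.curryLeft x - g.curryLeft x := rfl

lemma compLinearMap_id_sub_smulRight (ε : V →ₗ[R] R) (e : V) {p : ℕ}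
    (f : V [⋀^Fin (p + 1)]→ₗ[R] M) :
    f.compLinearMap (LinearMap.id - ε.smulRight e) = f - wedge ε p (f.curryLeft e) := by
  induction p with
  | zero =>
    refine ext_curryLeft fun x => ?_
    rw [AlternatingMap.curryLeft_compLinearMap, compLinearMap_of_isEmpty, curryLeft_sub]
    simp [curryLeft_wedge_zero]
  | succ p ih =>
    refine ext_curryLeft fun x => ?_
    rw [AlternatingMap.curryLeft_compLinearMap, ih, curryLeft_sub, curryLeft_wedge,
      curryLeft_curryLeft_comm f e x]
    simp [curryLeft_sub]
    abel

/-- The map induced on alternating maps by a linear map of the values and a linear map of the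
arguments. -/
def mapAlt (φ : M →ₗ[R] N) (u : W →ₗ[R] V) (p : ℕ) :
    (V [⋀^Fin p]→ₗ[R] M) →ₗ[R] (W [⋀^Fin p]→ₗ[R] N) where
  toFun f := (φ.compAlternatingMap f).compLinearMap u
  map_add' f g := by ext; simp
  map_smul' a f := by ext; simp

@[simp]
lemma mapAlt_apply (φ : M →ₗ[R] N) (u : W →ₗ[R] V) {p : ℕ} (f : V [⋀^Fin p]→ₗ[R] M)
    (v : Fin p → W) : mapAlt φ u p f v = φ (f (u ∘ v)) := rfl

lemma mapAlt_id_injective {φ : M →ₗ[R] N} (hφ : Function.Injective φ) (p : ℕ) :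
    Function.Injective (mapAlt φ (LinearMap.id : V →ₗ[R] V) p) :=
  fun _ _ h => AlternatingMap.ext fun v => hφ congr($h v)

lemma mapAlt_id_wedge (φ : M →ₗ[R] N) (ε : V →ₗ[R] R) (p : ℕ) (g : V [⋀^Fin p]→ₗ[R] M) :
    mapAlt φ LinearMap.id (p + 1) (wedge ε p g) = wedge ε p (mapAlt φ LinearMap.id p g) := by
  ext v
  simp [wedge_apply]

lemma exists_mapAlt_id_eq {φ : M →ₗ[R] N} (hφ : Function.Injective φ) {P : Submodule R M} {p : ℕ}
    {f : V [⋀^Fin p]→ₗ[R] N} (hf : ∀ v, f v ∈ P.map φ) :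
    ∃ g : V [⋀^Fin p]→ₗ[R] M, (∀ v, g v ∈ P) ∧ mapAlt φ LinearMap.id p g = f := by
  let e := LinearEquiv.ofInjective φ hφ
  let f' := f.codRestrict (LinearMap.range φ) fun v => LinearMap.map_le_range (hf v)
  let g := e.symm.toLinearMap.compAlternatingMap f'
  have φ_g (v : Fin p → V) : φ (g v) = f v := congrArg Subtype.val (e.apply_symm_apply (f' v))
  refine ⟨g, fun v => ?_, AlternatingMap.ext φ_g⟩
  obtain ⟨m, hm, hmv⟩ := hf v
  rwa [← hφ (hmv.trans (φ_g v).symm)]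

end Alternating

section KillCompl

variable {σ τ R : Type*} [CommSemiring R]

lemma killCompl_X_eq_zero {i : σ → τ} (hi : Function.Injective i) {t : τ}
    (ht : t ∉ Set.range i) : killCompl hi (X t : MvPolynomial τ R) = 0 := by
  rw [killCompl, aeval_X, dif_neg ht]

lemma killCompl_X {i : σ → τ} (hi : Function.Injective i) (s : σ) :
    killCompl hi (X (i s) : MvPolynomial τ R) = X s := by
  rw [← rename_X, killCompl_rename_app]

lemma killCompl_comp_rename_eq_killCompl {υ : Type*} {i : σ → τ} (hi : Function.Injective i)
    {j : τ → υ} (hj : Function.Injective j) :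
    (killCompl (hj.comp hi)).comp (rename j) = killCompl (R := R) hi := by
  refine MvPolynomial.algHom_ext fun t => ?_
  rw [AlgHom.comp_apply, rename_X]
  by_cases ht : t ∈ Set.range i
  · obtain ⟨s, rfl⟩ := ht
    exact (killCompl_X (hj.comp hi) s).trans (killCompl_X hi s).symm
  · rw [killCompl_X_eq_zero hi ht, killCompl_X_eq_zero]
    rintro ⟨s, hs⟩
    exact ht ⟨s, hj hs⟩

end KillCompl

section Complex

variable {σ τ K M N : Type*} [Fintype σ] [DecidableEq σ] [Fintype τ] [DecidableEq τ] [Field K]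
  [AddCommGroup M] [Module (MvPolynomial σ K) M] [Module K M]
  [IsScalarTower K (MvPolynomial σ K) M]
  [AddCommGroup N] [Module (MvPolynomial τ K) N] [Module K N]
  [IsScalarTower K (MvPolynomial τ K) N]

lemma koszulD_eq_sum {p : ℕ} (f : (σ → K) [⋀^Fin (p + 1)]→ₗ[K] M) :
    koszulD σ K M p f = ∑ s, (X s : MvPolynomial σ K) • f.curryLeft (Pi.single s 1) := rfl

lemma koszulD_apply {p : ℕ} (f : (σ → K) [⋀^Fin (p + 1)]→ₗ[K] M) (v : Fin p → σ → K) :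
    koszulD σ K M p f v =
      ∑ s, (X s : MvPolynomial σ K) • f (Matrix.vecCons (Pi.single s 1) v) :=
  map_sum ({ toFun := (· v), map_zero' := rfl, map_add' := fun _ _ => rfl } :
    ((σ → K) [⋀^Fin p]→ₗ[K] M) →+ M) _ _

lemma koszulD_smul {p : ℕ} (a : MvPolynomial σ K) (f : (σ → K) [⋀^Fin (p + 1)]→ₗ[K] M) :
    koszulD σ K M p (a • f) = a • koszulD σ K M p f := by
  ext v
  simp [koszulD_apply, Finset.smul_sum, smul_comm a]

lemma curryLeft_koszulD {p : ℕ} (f : (σ → K) [⋀^Fin (p + 2)]→ₗ[K] M) (x : σ → K) :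
    (koszulD σ K M (p + 1) f).curryLeft x = -koszulD σ K M p (f.curryLeft x) := by
  ext v
  rw [AlternatingMap.curryLeft_apply_apply, AlternatingMap.neg_apply, koszulD_apply,
    koszulD_apply, ← Finset.sum_neg_distrib]
  refine Finset.sum_congr rfl fun s _ => ?_
  rw [← smul_neg]
  exact congr(_ • $(curryLeft_curryLeft_comm f (Pi.single s 1) x) v)

lemma koszulD_wedge_zero (y : σ) (g : (σ → K) [⋀^Fin 0]→ₗ[K] M) :
    koszulD σ K M 0 (wedge (LinearMap.proj y) 0 g) = (X y : MvPolynomial σ K) • g := by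
  simp [koszulD_eq_sum, curryLeft_wedge_zero, Pi.single_apply]

lemma koszulD_wedge (y : σ) {p : ℕ} (g : (σ → K) [⋀^Fin (p + 1)]→ₗ[K] M) :
    koszulD σ K M (p + 1) (wedge (LinearMap.proj y) (p + 1) g) =
      (X y : MvPolynomial σ K) • g - wedge (LinearMap.proj y) p (koszulD σ K M p g) := by
  have wedge_smul (a : MvPolynomial σ K) (h : (σ → K) [⋀^Fin p]→ₗ[K] M) :
      wedge (LinearMap.proj y) p (a • h) = a • wedge (LinearMap.proj y) p h := by
    ext v
    simp [wedge_apply, Finset.smul_sum, smul_comm a]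
  simp [koszulD_eq_sum, curryLeft_wedge, wedge_smul, smul_sub, Pi.single_apply]

lemma koszulD_wedge_of_mem_koszulCycles (y : σ) {p : ℕ} {g : (σ → K) [⋀^Fin p]→ₗ[K] M}
    (hg : g ∈ koszulCycles σ K M p) :
    koszulD σ K M p (wedge (LinearMap.proj y) p g) = (X y : MvPolynomial σ K) • g := by
  cases p with
  | zero => exact koszulD_wedge_zero y g
  | succ p => rw [koszulD_wedge, show koszulD σ K M p g = 0 from hg, map_zero, sub_zero]

lemma curryLeft_mem_koszulCycles {p : ℕ} {f : (σ → K) [⋀^Fin (p + 1)]→ₗ[K] M}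
    (hf : f ∈ koszulCycles σ K M (p + 1)) (x : σ → K) :
    f.curryLeft x ∈ koszulCycles σ K M p := by
  cases p with
  | zero => trivial
  | succ p =>
    change koszulD σ K M p (f.curryLeft x) = 0
    rw [← neg_eq_zero, ← curryLeft_koszulD, show koszulD σ K M (p + 1) f = 0 from hf]
    simp

/-- Compatibility of linear maps of the coefficients and of the arguments with the contraction
by `∑ x_s e_s`, which makes `mapAlt φ u` a map of Koszul complexes. -/
def CommutesWithContraction (φ : M →ₗ[K] N) (u : (τ → K) →ₗ[K] (σ → K)) : Prop :=
  ∀ ℓ : (σ → K) →ₗ[K] M,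
    ∑ t, (X t : MvPolynomial τ K) • φ (ℓ (u (Pi.single t 1))) =
      φ (∑ s, (X s : MvPolynomial σ K) • ℓ (Pi.single s 1))

namespace CommutesWithContraction

variable {φ : M →ₗ[K] N} {u : (τ → K) →ₗ[K] (σ → K)}

lemma koszulD_mapAlt (h : CommutesWithContraction φ u) {p : ℕ}
    (f : (σ → K) [⋀^Fin (p + 1)]→ₗ[K] M) :
    koszulD τ K N p (mapAlt φ u (p + 1) f) = mapAlt φ u p (koszulD σ K M p f) := by
  ext v
  let ℓ : (σ → K) →ₗ[K] M :=
    { toFun := fun x => f.curryLeft x (u ∘ v)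
      map_add' := by simp
      map_smul' := by simp }
  have comp_vecCons (x : τ → K) : u ∘ Matrix.vecCons x v = Matrix.vecCons (u x) (u ∘ v) :=
    Fin.comp_cons u x v
  simp only [mapAlt_apply, koszulD_apply, comp_vecCons]
  exact h ℓ

lemma mapAlt_mem_koszulCycles (h : CommutesWithContraction φ u) {p : ℕ}
    {f : (σ → K) [⋀^Fin p]→ₗ[K] M} (hf : f ∈ koszulCycles σ K M p) :
    mapAlt φ u p f ∈ koszulCycles τ K N p := by
  cases p with
  | zero => trivial
  | succ p =>
    change koszulD τ K N p (mapAlt φ u (p + 1) f) = 0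
    rw [h.koszulD_mapAlt, show koszulD σ K M p f = 0 from hf, map_zero]

end CommutesWithContraction

lemma commutesWithContraction_id {M N : Type*}
    [AddCommGroup M] [Module (MvPolynomial σ K) M] [Module K M]
    [IsScalarTower K (MvPolynomial σ K) M]
    [AddCommGroup N] [Module (MvPolynomial σ K) N] [Module K N]
    [IsScalarTower K (MvPolynomial σ K) N] (φ : M →ₗ[MvPolynomial σ K] N) :
    CommutesWithContraction (φ.restrictScalars K) (LinearMap.id : (σ → K) →ₗ[K] (σ → K)) := by
  intro ℓ
  simp

lemma commutesWithContraction_rename {i : σ → τ} (hi : Function.Injective i) :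
    CommutesWithContraction (rename i : MvPolynomial σ K →ₐ[K] MvPolynomial τ K).toLinearMap
      (LinearMap.funLeft K K i) := by
  intro ℓ
  have funLeft_single_eq_zero (t : τ) (ht : t ∉ Set.range i) :
      LinearMap.funLeft K K i (Pi.single t 1) = 0 := by
    ext s
    exact Pi.single_eq_of_ne (fun h => ht ⟨s, h⟩) _
  have funLeft_single_apply (s : σ) :
      LinearMap.funLeft K K i (Pi.single (i s) 1) = Pi.single s 1 := by
    ext s'
    simp [Pi.single_apply, hi.eq_iff]
  rw [map_sum]
  refine (Fintype.sum_of_injective i hi _ _ (fun t ht => ?_) fun s => ?_).symm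
  · rw [funLeft_single_eq_zero t ht, map_zero, map_zero, smul_zero]
  · simp [funLeft_single_apply]

lemma commutesWithContraction_killCompl {i : σ → τ} (hi : Function.Injective i) :
    CommutesWithContraction (killCompl hi : MvPolynomial τ K →ₐ[K] MvPolynomial σ K).toLinearMap
      (Function.ExtendByZero.linearMap K i) := by
  intro ℓ
  have extend_single (s : σ) :
      Function.ExtendByZero.linearMap K i (Pi.single s 1) = Pi.single (i s) 1 := by
    ext t
    by_cases ht : t ∈ Set.range i
    · obtain ⟨s', rfl⟩ := ht
      simp [Pi.single_apply, hi.extend_apply, hi.eq_iff]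
    · rw [Pi.single_eq_of_ne (fun h => ht ⟨s, h.symm⟩)]
      exact Function.extend_apply' _ _ _ ht
  rw [map_sum]
  refine Fintype.sum_of_injective i hi _ _ (fun t ht => ?_) fun s => ?_
  · simp [killCompl_X_eq_zero hi ht]
  · simp [extend_single, killCompl_X]

end Complex

section Homology

variable (σ : Type*) {K M N : Type*} [Fintype σ] [DecidableEq σ] [Field K]
  [AddCommGroup M] [Module (MvPolynomial σ K) M] [Module K M]
  [IsScalarTower K (MvPolynomial σ K) M]
  [AddCommGroup N] [Module (MvPolynomial σ K) N] [Module K N]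
  [IsScalarTower K (MvPolynomial σ K) N]

/-- Nonvanishing of the Koszul homology of `M` in homological degree `p`, on cycles with
coefficients of degree `d`. As the basis vectors of `⋀^p(K^σ)` have degree `p`, this is
`Tor_p(K, M)_{d + p} ≠ 0`. -/
def HasKoszulHomology (ℳ : ℤ → Submodule K M) (p : ℕ) (d : ℤ) : Prop :=
  ∃ f ∈ koszulCycles σ K M p, (∀ v, f v ∈ ℳ d) ∧
    ∀ g : (σ → K) [⋀^Fin (p + 1)]→ₗ[K] M, (∀ v, g v ∈ ℳ (d - 1)) → koszulD σ K M p g ≠ f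

variable {σ}

lemma not_hasKoszulHomology_iff {ℳ : ℤ → Submodule K M} {p : ℕ} {d : ℤ} :
    ¬ HasKoszulHomology σ ℳ p d ↔ ∀ f ∈ koszulCycles σ K M p, (∀ v, f v ∈ ℳ d) →
      ∃ g : (σ → K) [⋀^Fin (p + 1)]→ₗ[K] M, (∀ v, g v ∈ ℳ (d - 1)) ∧
        koszulD σ K M p g = f := by
  simp [HasKoszulHomology]

lemma nontrivial_gradedTor_iff (ℳ : ℤ → Submodule K M) (p : ℕ) (j : ℤ) :
    Nontrivial (GradedTor σ ℳ p j) ↔ HasKoszulHomology σ ℳ p (j - p) := by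
  have hj : j - ((p + 1 : ℕ) : ℤ) = j - p - 1 := by push_cast; ring
  rw [GradedTor, Submodule.Quotient.nontrivial_iff, Ne, Submodule.submoduleOf,
    Submodule.comap_subtype_eq_top, SetLike.not_le_iff_exists, HasKoszulHomology, ← hj]
  constructor
  · rintro ⟨f, ⟨hf, hfd⟩, hfb⟩
    exact ⟨f, hf, hfd, fun g hg hgf => hfb ⟨g, hg, hgf⟩⟩
  · rintro ⟨f, hf, hfd, hfb⟩
    exact ⟨f, ⟨hf, hfd⟩, fun ⟨g, hg, hgf⟩ => hfb g hg hgf⟩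

lemma gradedReg_eq_sSup (ℳ : ℤ → Submodule K M) :
    gradedReg σ ℳ = sSup {d | ∃ p, HasKoszulHomology σ ℳ p d} := by
  simp only [gradedReg, nontrivial_gradedTor_iff]
  congr! 3 with d
  constructor
  · rintro ⟨p, j, h, rfl⟩
    exact ⟨p, h⟩
  · rintro ⟨p, h⟩
    exact ⟨p, d + p, by simpa using h, by simp⟩

variable {ι : M →ₗ[MvPolynomial σ K] N}

lemma mapAlt_mem_koszulCycles_iff (hι : Function.Injective ι) {p : ℕ}
    {f : (σ → K) [⋀^Fin p]→ₗ[K] M} :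
    mapAlt (ι.restrictScalars K) LinearMap.id p f ∈ koszulCycles σ K N p ↔
      f ∈ koszulCycles σ K M p := by
  refine ⟨fun hf => ?_, (commutesWithContraction_id ι).mapAlt_mem_koszulCycles⟩
  cases p with
  | zero => trivial
  | succ p =>
    refine mapAlt_id_injective (φ := ι.restrictScalars K) hι p ?_
    rw [map_zero, ← (commutesWithContraction_id ι).koszulD_mapAlt]
    exact hf

lemma hasKoszulHomology_map_iff (hι : Function.Injective ι) {ℳ : ℤ → Submodule K M} {p : ℕ}
    {d : ℤ} :
    HasKoszulHomology σ (fun d => (ℳ d).map (ι.restrictScalars K)) p d ↔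
      HasKoszulHomology σ ℳ p d := by
  have hι' : Function.Injective (ι.restrictScalars K) := hι
  constructor
  · rintro ⟨f', hf, hfd', hfb⟩
    obtain ⟨f, hfd, rfl⟩ := exists_mapAlt_id_eq hι' hfd'
    refine ⟨f, (mapAlt_mem_koszulCycles_iff hι).1 hf, hfd, fun g hg hgf => ?_⟩
    refine hfb (mapAlt (ι.restrictScalars K) LinearMap.id (p + 1) g) (fun v => ⟨_, hg v, rfl⟩) ?_
    rw [(commutesWithContraction_id ι).koszulD_mapAlt, hgf]
  · rintro ⟨f, hf, hfd, hfb⟩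
    refine ⟨_, (mapAlt_mem_koszulCycles_iff hι).2 hf, fun v => ⟨_, hfd v, rfl⟩,
      fun g' hg' hgf => ?_⟩
    obtain ⟨g, hg, rfl⟩ := exists_mapAlt_id_eq hι' hg'
    rw [(commutesWithContraction_id ι).koszulD_mapAlt] at hgf
    exact hfb g hg (mapAlt_id_injective hι' p hgf)

end Homology

section Pieces

variable {σ τ K : Type*} [Field K]

/-- The polynomials in the ideal `J` that are homogeneous of degree `d`: the `d`-th graded piece
of `J` as a subspace of the polynomial ring. -/
noncomputable def piece (J : Ideal (MvPolynomial σ K)) (d : ℤ) : Submodule K (MvPolynomial σ K) :=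
  (J.stdGrading d).map (J.subtype.restrictScalars K)

lemma mem_piece {J : Ideal (MvPolynomial σ K)} {d : ℤ} {f : MvPolynomial σ K} :
    f ∈ piece J d ↔ f ∈ J ∧ ∀ m, f.coeff m ≠ 0 → (m.degree : ℤ) = d := by
  constructor
  · rintro ⟨f, hf, rfl⟩
    exact ⟨f.2, hf⟩
  · exact fun ⟨hf, hfd⟩ => ⟨⟨f, hf⟩, hfd, rfl⟩

lemma mem_piece_iff_mem_piece_top {J : Ideal (MvPolynomial σ K)} {d : ℤ} {f : MvPolynomial σ K} :
    f ∈ piece J d ↔ f ∈ J ∧ f ∈ piece ⊤ d := by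
  simp [mem_piece]

lemma reg_eq_sSup [Fintype σ] [DecidableEq σ] (J : Ideal (MvPolynomial σ K)) :
    J.reg = sSup {d | ∃ p, HasKoszulHomology σ (piece J) p d} := by
  rw [Ideal.reg, gradedReg_eq_sSup]
  congr! 5
  exact (hasKoszulHomology_map_iff J.subtype_injective).symm

lemma monomial_mem_piece_top (m : σ →₀ ℕ) (a : K) : monomial m a ∈ piece ⊤ (m.degree : ℤ) := by
  classical
  refine mem_piece.2 ⟨trivial, fun n hn => ?_⟩
  rw [coeff_monomial] at hn
  rw [(ite_ne_right_iff.1 hn).1]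

lemma map_mem_piece_top {φ : MvPolynomial σ K →ₗ[K] MvPolynomial τ K} {d d' : ℤ}
    (hφ : ∀ (m : σ →₀ ℕ) (a : K), (m.degree : ℤ) = d → φ (monomial m a) ∈ piece ⊤ d')
    {f : MvPolynomial σ K} (hf : f ∈ piece ⊤ d) : φ f ∈ piece ⊤ d' := by
  rw [f.as_sum, map_sum]
  exact Submodule.sum_mem _ fun m hm => hφ m _ ((mem_piece.1 hf).2 m (mem_support_iff.1 hm))

lemma X_mul_mem_piece_top (y : σ) {d : ℤ} {f : MvPolynomial σ K} (hf : f ∈ piece ⊤ (d - 1)) :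
    X y * f ∈ piece ⊤ d := by
  refine map_mem_piece_top (φ := LinearMap.mulLeft K (X y)) (fun m a hm => ?_) hf
  have h := monomial_mem_piece_top (Finsupp.single y 1 + m) a
  rw [LinearMap.mulLeft_apply, X, monomial_mul, one_mul]
  convert h using 1
  simp [map_add, hm]

lemma rename_mem_piece_top (i : σ → τ) {d : ℤ} {f : MvPolynomial σ K} (hf : f ∈ piece ⊤ d) :
    rename i f ∈ piece ⊤ d := by
  refine map_mem_piece_top (φ := (rename i).toLinearMap) (fun m a hm => ?_) hf
  have h := monomial_mem_piece_top (m.mapDomain i) a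
  rw [AlgHom.toLinearMap_apply, rename_monomial]
  rwa [Finsupp.degree_mapDomain, hm] at h

lemma killCompl_mem_piece_top {i : σ → τ} (hi : Function.Injective i) {d : ℤ}
    {f : MvPolynomial τ K} (hf : f ∈ piece ⊤ d) : killCompl hi f ∈ piece ⊤ d := by
  refine map_mem_piece_top (φ := (killCompl hi).toLinearMap) (fun m a hm => ?_) hf
  rw [AlgHom.toLinearMap_apply]
  by_cases h : (m.support : Set τ) ⊆ Set.range i
  · obtain ⟨n, rfl⟩ : ∃ n, Finsupp.mapDomain i n = m :=
      ⟨_, Finsupp.mapDomain_comapDomain i hi m h⟩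
    rw [killCompl_monomial_mapDomain, ← hm, Finsupp.degree_mapDomain]
    exact monomial_mem_piece_top _ _
  · rw [killCompl_monomial_eq_zero_of_not_subset hi a h]
    exact Submodule.zero_mem _

/-- Division by the variable `y` with remainder: the quotient. -/
noncomputable def divX (y : σ) : MvPolynomial σ K →ₗ[K] MvPolynomial σ K where
  toFun g := g.divMonomial (Finsupp.single y 1)
  map_add' f g := add_divMonomial f g _
  map_smul' a g := by
    ext m
    simp [coeff_divMonomial]

lemma coeff_divX (y : σ) (g : MvPolynomial σ K) (m : σ →₀ ℕ) :
    (divX y g).coeff m = g.coeff (Finsupp.single y 1 + m) := coeff_divMonomial _ _ _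

lemma divX_mem_piece_top (y : σ) {d : ℤ} {g : MvPolynomial σ K} (hg : g ∈ piece ⊤ d) :
    divX y g ∈ piece ⊤ (d - 1) := by
  refine mem_piece.2 ⟨trivial, fun m hm => ?_⟩
  rw [coeff_divX] at hm
  have h := (mem_piece.1 hg).2 _ hm
  rw [map_add, Finsupp.degree_single] at h
  push_cast at h
  omega

lemma X_dvd_sub_rename_killCompl {i : σ → τ} (hi : Function.Injective i) {y : τ}
    (hy : Set.range i = {y}ᶜ) (g : MvPolynomial τ K) :
    X y ∣ g - rename i (killCompl hi g) := by
  induction g using MvPolynomial.induction_on with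
  | C a => simp
  | add f g hf hg =>
    simpa only [map_add, add_sub_add_comm] using dvd_add hf hg
  | mul_X g t hg =>
    by_cases ht : t ∈ Set.range i
    · obtain ⟨s, rfl⟩ := ht
      rw [map_mul, map_mul, killCompl_X, rename_X, ← sub_mul]
      exact dvd_mul_of_dvd_left hg _
    · have t_eq : t = y := by simpa [hy] using ht
      rw [map_mul, killCompl_X_eq_zero hi ht, mul_zero, map_zero, sub_zero, t_eq]
      exact dvd_mul_left _ _

lemma X_mul_divX_add_rename_killCompl {i : σ → τ} (hi : Function.Injective i) {y : τ}
    (hy : Set.range i = {y}ᶜ) (g : MvPolynomial τ K) :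
    X y * divX y g + rename i (killCompl hi g) = g := by
  have remainder : rename i (killCompl hi g) = g.modMonomial (Finsupp.single y 1) := by
    refine (eq_modMonomial_single_iff (X_dvd_sub_rename_killCompl hi hy g)).2 fun m hm => ?_
    obtain ⟨n, rfl, -⟩ := coeff_rename_ne_zero i _ m (mem_support_iff.1 hm)
    exact Finsupp.mapDomain_of_notMem_range _ _ (by simp [hy])
  rw [remainder]
  exact divMonomial_add_modMonomial_single g y

end Pieces

section Retract

variable {σ τ K : Type*} [Field K]

/-- `J` is a retract of `J'`: an inclusion `i` of the variables maps `J` into `J'`, and setting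
the other variables to zero maps `J'` into `J`. -/
structure IsRetract {i : σ → τ} (hi : Function.Injective i) (J : Ideal (MvPolynomial σ K))
    (J' : Ideal (MvPolynomial τ K)) : Prop where
  rename_mem : ∀ g ∈ J, rename i g ∈ J'
  killCompl_mem : ∀ g ∈ J', killCompl hi g ∈ J

lemma isRetract_top {i : σ → τ} (hi : Function.Injective i) :
    IsRetract hi (⊤ : Ideal (MvPolynomial σ K)) ⊤ := ⟨fun _ _ => trivial, fun _ _ => trivial⟩

/-- The map of Koszul complexes induced by an inclusion of the variables. -/
noncomputable def extendChain (i : σ → τ) {p : ℕ}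
    (f : (σ → K) [⋀^Fin p]→ₗ[K] MvPolynomial σ K) : (τ → K) [⋀^Fin p]→ₗ[K] MvPolynomial τ K :=
  mapAlt (rename i).toLinearMap (LinearMap.funLeft K K i) p f

/-- The map of Koszul complexes induced by setting the variables outside the range of `i` to
zero. -/
noncomputable def restrictChain {i : σ → τ} (hi : Function.Injective i) {p : ℕ}
    (f : (τ → K) [⋀^Fin p]→ₗ[K] MvPolynomial τ K) : (σ → K) [⋀^Fin p]→ₗ[K] MvPolynomial σ K :=
  mapAlt (killCompl hi).toLinearMap (Function.ExtendByZero.linearMap K i) p f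

variable {i : σ → τ} {hi : Function.Injective i} {J : Ideal (MvPolynomial σ K)}
  {J' : Ideal (MvPolynomial τ K)}

lemma extendChain_apply {p : ℕ} (f : (σ → K) [⋀^Fin p]→ₗ[K] MvPolynomial σ K)
    (v : Fin p → τ → K) : extendChain i f v = rename i (f fun j s => v j (i s)) := rfl

lemma restrictChain_extendChain {p : ℕ} (f : (σ → K) [⋀^Fin p]→ₗ[K] MvPolynomial σ K) :
    restrictChain hi (extendChain i f) = f := by
  ext v : 1
  simp [restrictChain, extendChain_apply, killCompl_rename_app, hi.extend_apply]

namespace IsRetract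

lemma extendChain_mem_piece (h : IsRetract hi J J') {p : ℕ} {d : ℤ}
    {f : (σ → K) [⋀^Fin p]→ₗ[K] MvPolynomial σ K} (hf : ∀ v, f v ∈ piece J d)
    (v : Fin p → τ → K) : extendChain i f v ∈ piece J' d := by
  have := mem_piece_iff_mem_piece_top.1 (hf (LinearMap.funLeft K K i ∘ v))
  exact mem_piece_iff_mem_piece_top.2
    ⟨h.rename_mem _ this.1, rename_mem_piece_top i this.2⟩

lemma restrictChain_mem_piece (h : IsRetract hi J J') {p : ℕ} {d : ℤ}
    {f : (τ → K) [⋀^Fin p]→ₗ[K] MvPolynomial τ K} (hf : ∀ v, f v ∈ piece J' d)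
    (v : Fin p → σ → K) : restrictChain hi f v ∈ piece J d := by
  have := mem_piece_iff_mem_piece_top.1 (hf (Function.ExtendByZero.linearMap K i ∘ v))
  exact mem_piece_iff_mem_piece_top.2
    ⟨h.killCompl_mem _ this.1, killCompl_mem_piece_top hi this.2⟩

variable [Fintype σ] [DecidableEq σ] [Fintype τ] [DecidableEq τ]

lemma hasKoszulHomology (h : IsRetract hi J J') {p : ℕ} {d : ℤ}
    (hJ : HasKoszulHomology σ (piece J) p d) : HasKoszulHomology τ (piece J') p d := by
  obtain ⟨f, hf, hfd, hfb⟩ := hJ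
  refine ⟨extendChain i f, (commutesWithContraction_rename hi).mapAlt_mem_koszulCycles hf,
    h.extendChain_mem_piece hfd,
    fun g hg hgf => hfb (restrictChain hi g) (h.restrictChain_mem_piece hg) ?_⟩
  rw [restrictChain, (commutesWithContraction_killCompl hi).koszulD_mapAlt, hgf]
  exact restrictChain_extendChain f

lemma exists_koszulD_eq_extendChain (h : IsRetract hi J J') {p : ℕ} {d : ℤ}
    (hJ : ¬ HasKoszulHomology σ (piece J) p d) {f : (τ → K) [⋀^Fin p]→ₗ[K] MvPolynomial τ K}
    (hf : f ∈ koszulCycles τ K _ p) (hfd : ∀ v, f v ∈ piece J' d) :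
    ∃ b : (τ → K) [⋀^Fin (p + 1)]→ₗ[K] MvPolynomial τ K, (∀ v, b v ∈ piece J' (d - 1)) ∧
      koszulD τ K _ p b = extendChain i (restrictChain hi f) := by
  obtain ⟨g, hg, hgf⟩ := not_hasKoszulHomology_iff.1 hJ (restrictChain hi f)
    ((commutesWithContraction_killCompl hi).mapAlt_mem_koszulCycles hf)
    (h.restrictChain_mem_piece hfd)
  refine ⟨extendChain i g, h.extendChain_mem_piece hg, ?_⟩
  rw [extendChain, (commutesWithContraction_rename hi).koszulD_mapAlt, hgf, extendChain]

end IsRetract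

end Retract

section AdjoinVariable

variable {σ τ K : Type*} [Field K] {i : σ → τ} (hi : Function.Injective i) {y : τ}
  (hy : Set.range i = {y}ᶜ)

/-- Coefficientwise division by the variable `y`. -/
noncomputable def divXChain (y : τ) {p : ℕ} (f : (τ → K) [⋀^Fin p]→ₗ[K] MvPolynomial τ K) :
    (τ → K) [⋀^Fin p]→ₗ[K] MvPolynomial τ K :=
  mapAlt (divX y) LinearMap.id p f

lemma divXChain_apply_mem_piece_top {J' : Ideal (MvPolynomial τ K)} {p : ℕ}
    {d : ℤ} {f : (τ → K) [⋀^Fin p]→ₗ[K] MvPolynomial τ K} (hfd : ∀ v, f v ∈ piece J' d)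
    (v : Fin p → τ → K) : divXChain y f v ∈ piece ⊤ (d - 1) :=
  divX_mem_piece_top y (mem_piece_iff_mem_piece_top.1 (hfd v)).2

lemma extendChain_restrictChain_zero (f : (τ → K) [⋀^Fin 0]→ₗ[K] MvPolynomial τ K) :
    extendChain i (restrictChain hi f) =
      mapAlt ((rename i).comp (killCompl hi)).toLinearMap LinearMap.id 0 f := by
  ext v : 1
  exact congrArg (rename i ∘ killCompl hi ∘ f) (Subsingleton.elim _ _)

include hy

lemma X_smul_divXChain_add {p : ℕ} (f : (τ → K) [⋀^Fin p]→ₗ[K] MvPolynomial τ K) :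
    (X y : MvPolynomial τ K) • divXChain y f +
      mapAlt ((rename i).comp (killCompl hi)).toLinearMap LinearMap.id p f = f := by
  ext v : 1
  exact X_mul_divX_add_rename_killCompl hi hy (f v)

variable [DecidableEq τ]

include hi in
lemma extendByZero_comp_funLeft :
    Function.ExtendByZero.linearMap K i ∘ₗ LinearMap.funLeft K K i =
      LinearMap.id - (LinearMap.proj y).smulRight (Pi.single y 1) := by
  refine LinearMap.ext fun v => ?_
  funext t
  change Function.extend i (v ∘ i) 0 t = v t - v y • (Pi.single y 1 : τ → K) t
  by_cases ht : t ∈ Set.range i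
  · obtain ⟨s, rfl⟩ := ht
    have : i s ≠ y := by simpa [hy] using Set.mem_range_self (f := i) s
    simp [hi.extend_apply, this]
  · obtain rfl : t = y := by simpa [hy] using ht
    simp [Function.extend_apply' _ _ _ ht]

lemma extendChain_restrictChain_succ {p : ℕ}
    (f : (τ → K) [⋀^Fin (p + 1)]→ₗ[K] MvPolynomial τ K) :
    extendChain i (restrictChain hi f) =
      mapAlt ((rename i).comp (killCompl hi)).toLinearMap LinearMap.id (p + 1)
        (f - wedge (LinearMap.proj y) p (f.curryLeft (Pi.single y 1))) := by
  rw [← compLinearMap_id_sub_smulRight, ← extendByZero_comp_funLeft hi hy]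
  rfl

lemma extendChain_restrictChain_curryLeft {p : ℕ}
    (f : (τ → K) [⋀^Fin (p + 1)]→ₗ[K] MvPolynomial τ K) :
    extendChain i (restrictChain hi (f.curryLeft (Pi.single y 1))) =
      mapAlt ((rename i).comp (killCompl hi)).toLinearMap LinearMap.id p
        (f.curryLeft (Pi.single y 1)) := by
  cases p with
  | zero => exact extendChain_restrictChain_zero hi _
  | succ p =>
    rw [extendChain_restrictChain_succ hi hy, AlternatingMap.curryLeft_same, map_zero, sub_zero]

lemma X_smul_divXChain_add_extendChain_add_wedge {p : ℕ}
    (f : (τ → K) [⋀^Fin (p + 1)]→ₗ[K] MvPolynomial τ K) :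
    (X y : MvPolynomial τ K) • divXChain y f + extendChain i (restrictChain hi f) +
      wedge (LinearMap.proj y) p
        (extendChain i (restrictChain hi (f.curryLeft (Pi.single y 1)))) = f := by
  conv_rhs => rw [← X_smul_divXChain_add hi hy f]
  rw [add_assoc, extendChain_restrictChain_succ hi hy, extendChain_restrictChain_curryLeft hi hy,
    ← mapAlt_id_wedge, ← map_add, sub_add_cancel]

variable [Fintype τ]

lemma koszulD_divXChain {p : ℕ} {f : (τ → K) [⋀^Fin (p + 1)]→ₗ[K] MvPolynomial τ K}
    (hf : f ∈ koszulCycles τ K _ (p + 1)) :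
    koszulD τ K _ p (divXChain y f) =
      -extendChain i (restrictChain hi (f.curryLeft (Pi.single y 1))) := by
  have retract_mem {q : ℕ} {g : (τ → K) [⋀^Fin q]→ₗ[K] MvPolynomial τ K}
      (hg : g ∈ koszulCycles τ K _ q) :
      extendChain i (restrictChain hi g) ∈ koszulCycles τ K _ q := by
    classical
    have := Fintype.ofInjective i hi
    exact (commutesWithContraction_rename hi).mapAlt_mem_koszulCycles
      ((commutesWithContraction_killCompl hi).mapAlt_mem_koszulCycles hg)
  have hD := congrArg (koszulD τ K _ p) (X_smul_divXChain_add_extendChain_add_wedge hi hy f)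
  rw [map_add, map_add, koszulD_smul, show koszulD τ K _ p (extendChain i _) = 0 from
    retract_mem hf, add_zero, koszulD_wedge_of_mem_koszulCycles y
    (retract_mem (curryLeft_mem_koszulCycles hf _)), show koszulD τ K _ p f = 0 from hf,
    ← smul_add] at hD
  rw [eq_neg_iff_add_eq_zero]
  ext1 v
  exact (mul_eq_zero_iff_left (X_ne_zero y)).1 congr($hD v)

lemma koszulD_wedge_divXChain {p : ℕ} {f : (τ → K) [⋀^Fin p]→ₗ[K] MvPolynomial τ K}
    (hf : f ∈ koszulCycles τ K _ p) :
    koszulD τ K _ p (wedge (LinearMap.proj y) p (divXChain y f)) =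
      f - extendChain i (restrictChain hi f) := by
  cases p with
  | zero =>
    rw [koszulD_wedge_zero, eq_sub_iff_add_eq, extendChain_restrictChain_zero,
      X_smul_divXChain_add hi hy]
  | succ p =>
    rw [koszulD_wedge, koszulD_divXChain hi hy hf, map_neg, sub_neg_eq_add, eq_sub_iff_add_eq,
      add_right_comm, X_smul_divXChain_add_extendChain_add_wedge hi hy]

end AdjoinVariable

section Exactness

variable {τ K : Type*} [Fintype τ] [DecidableEq τ] [Field K]

lemma eq_zero_of_hasKoszulHomology_of_isEmpty [IsEmpty τ] {J : Ideal (MvPolynomial τ K)} {p : ℕ}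
    {d : ℤ} (h : HasKoszulHomology τ (piece J) p d) : p = 0 ∧ d = 0 := by
  obtain ⟨f, -, hfd, hfb⟩ := h
  have f_ne : f ≠ 0 := fun hf => hfb 0 (fun _ => Submodule.zero_mem _) (by rw [map_zero, hf])
  obtain ⟨v, hv⟩ := DFunLike.ne_iff.1 f_ne
  obtain ⟨m, hm⟩ := MvPolynomial.ne_zero_iff.1 hv
  refine ⟨?_, ?_⟩
  · by_contra hp
    exact hv (f.map_coord_zero ⟨0, Nat.pos_of_ne_zero hp⟩ (Subsingleton.elim _ _))
  · simpa [Subsingleton.elim m 0] using ((mem_piece.1 (hfd v)).2 m hm).symm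

theorem eq_zero_of_hasKoszulHomology_top {p : ℕ} {d : ℤ}
    (h : HasKoszulHomology τ (piece (⊤ : Ideal (MvPolynomial τ K))) p d) : p = 0 ∧ d = 0 := by
  induction hn : Fintype.card τ generalizing τ with
  | zero =>
    have := Fintype.card_eq_zero_iff.1 hn
    exact eq_zero_of_hasKoszulHomology_of_isEmpty h
  | succ n ih =>
    obtain ⟨y⟩ : Nonempty τ := Fintype.card_pos_iff.1 (by omega)
    let i : {t // t ≠ y} → τ := Subtype.val
    have hi : Function.Injective i := Subtype.val_injective
    have hy : Set.range i = {y}ᶜ := by ext; simp [i]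
    obtain ⟨f, hf, hfd, hfb⟩ := h
    by_contra hpd
    obtain ⟨b, hb, hbf⟩ := (isRetract_top hi).exists_koszulD_eq_extendChain
      (fun h' => hpd (ih h' (by simp [hn]))) hf hfd
    refine hfb (b + wedge (LinearMap.proj y) p (divXChain y f)) (fun v => ?_) ?_
    · exact Submodule.add_mem _ (hb v)
        (wedge_apply_mem _ (fun w => divX_mem_piece_top y (hfd w)) v)
    · rw [map_add, hbf, koszulD_wedge_divXChain hi hy hf, add_sub_cancel]

end Exactness

section AdjoinVariableHomology

variable {σ τ K : Type*} [Fintype σ] [DecidableEq σ] [Fintype τ] [DecidableEq τ] [Field K]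
  {i : σ → τ} {hi : Function.Injective i} {y : τ} (hy : Set.range i = {y}ᶜ)
  {J : Ideal (MvPolynomial σ K)} {J' : Ideal (MvPolynomial τ K)}

lemma exists_koszulD_eq_X_smul (hX : X y ∈ J') {p : ℕ} {d : ℤ} (hpd : p ≠ 0 ∨ d ≠ 1)
    {f : (τ → K) [⋀^Fin p]→ₗ[K] MvPolynomial τ K} (hf : f ∈ koszulCycles τ K _ p)
    (hfd : ∀ v, f v ∈ piece ⊤ (d - 1)) :
    ∃ b : (τ → K) [⋀^Fin (p + 1)]→ₗ[K] MvPolynomial τ K, (∀ v, b v ∈ piece J' (d - 1)) ∧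
      koszulD τ K _ p b = (X y : MvPolynomial τ K) • f := by
  have hacyclic : ¬ HasKoszulHomology τ (piece (⊤ : Ideal (MvPolynomial τ K))) p (d - 1) := by
    intro h
    have := eq_zero_of_hasKoszulHomology_top h
    omega
  obtain ⟨k, hk, rfl⟩ := not_hasKoszulHomology_iff.1 hacyclic f hf hfd
  refine ⟨(X y : MvPolynomial τ K) • k, fun v => ?_, koszulD_smul _ k⟩
  exact mem_piece_iff_mem_piece_top.2 ⟨J'.mul_mem_right _ hX, X_mul_mem_piece_top y (hk v)⟩

namespace IsRetract

variable (h : IsRetract hi J J')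

include h hy

lemma exists_koszulD_eq_zero (hX : X y ∈ J') {d : ℤ} (hd : d ≠ 1)
    (hJ : ∀ q, ¬ HasKoszulHomology σ (piece J) q d)
    {f : (τ → K) [⋀^Fin 0]→ₗ[K] MvPolynomial τ K} (hfd : ∀ v, f v ∈ piece J' d) :
    ∃ b : (τ → K) [⋀^Fin 1]→ₗ[K] MvPolynomial τ K, (∀ v, b v ∈ piece J' (d - 1)) ∧
      koszulD τ K _ 0 b = f := by
  obtain ⟨b, hb, hbf⟩ := h.exists_koszulD_eq_extendChain (hJ 0) (p := 0) trivial hfd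
  obtain ⟨k, hk, hkf⟩ := exists_koszulD_eq_X_smul hX (Or.inr hd) (f := divXChain y f) trivial
    (divXChain_apply_mem_piece_top hfd)
  refine ⟨k + b, fun v => Submodule.add_mem _ (hk v) (hb v), ?_⟩
  rw [map_add, hkf, hbf, extendChain_restrictChain_zero, X_smul_divXChain_add hi hy]

lemma exists_koszulD_eq_succ (hX : X y ∈ J') {p : ℕ} {d : ℤ}
    (hJ : ∀ q, ¬ HasKoszulHomology σ (piece J) q d)
    {f : (τ → K) [⋀^Fin (p + 1)]→ₗ[K] MvPolynomial τ K} (hf : f ∈ koszulCycles τ K _ (p + 1))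
    (hfd : ∀ v, f v ∈ piece J' d) :
    ∃ b : (τ → K) [⋀^Fin (p + 2)]→ₗ[K] MvPolynomial τ K, (∀ v, b v ∈ piece J' (d - 1)) ∧
      koszulD τ K _ (p + 1) b = f := by
  obtain ⟨b, hb, hbf⟩ := h.exists_koszulD_eq_extendChain (hJ (p + 1)) hf hfd
  obtain ⟨b', hb', hbf'⟩ := h.exists_koszulD_eq_extendChain (hJ p)
    (curryLeft_mem_koszulCycles hf (Pi.single y 1)) fun v => hfd _
  have quotient_cycle : divXChain y f + b' ∈ koszulCycles τ K _ (p + 1) := by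
    change koszulD τ K _ p (divXChain y f + b') = 0
    rw [map_add, koszulD_divXChain hi hy hf, hbf', neg_add_cancel]
  obtain ⟨k, hk, hkf⟩ := exists_koszulD_eq_X_smul hX (Or.inl p.succ_ne_zero) quotient_cycle
    fun v => Submodule.add_mem _ (divXChain_apply_mem_piece_top hfd v)
      (mem_piece_iff_mem_piece_top.1 (hb' v)).2
  refine ⟨k + b - wedge (LinearMap.proj y) (p + 1) b', fun v => Submodule.sub_mem _
    (Submodule.add_mem _ (hk v) (hb v)) (wedge_apply_mem _ hb' v), ?_⟩
  conv_rhs => rw [← X_smul_divXChain_add_extendChain_add_wedge hi hy f]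
  rw [map_sub, map_add, hkf, hbf, koszulD_wedge, hbf', smul_add]
  abel

lemma eq_one_or_hasKoszulHomology (hX : X y ∈ J') {p : ℕ} {d : ℤ}
    (hJ' : HasKoszulHomology τ (piece J') p d) :
    d = 1 ∨ ∃ q, HasKoszulHomology σ (piece J) q d := by
  by_contra! ⟨hd, hJ⟩
  revert hJ'
  rw [imp_false, not_hasKoszulHomology_iff]
  intro f hf hfd
  cases p with
  | zero => exact h.exists_koszulD_eq_zero hy hX hd hJ hfd
  | succ p => exact h.exists_koszulD_eq_succ hy hX hJ hf hfd

end IsRetract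

end AdjoinVariableHomology

section AdjoinVariables

variable {σ τ K : Type*} [Field K]

lemma isRetract_comap {i : σ → τ} (hi : Function.Injective i) {y : τ}
    (hy : Set.range i = {y}ᶜ) {J' : Ideal (MvPolynomial τ K)} (hX : X y ∈ J') :
    IsRetract hi (J'.comap (rename i)) J' := by
  refine ⟨fun g hg => hg, fun g hg => ?_⟩
  rw [← X_mul_divX_add_rename_killCompl hi hy g] at hg
  exact (J'.add_mem_iff_right (J'.mul_mem_right _ hX)).1 hg

variable {i : σ → τ} {hi : Function.Injective i} {J : Ideal (MvPolynomial σ K)}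
  {J' : Ideal (MvPolynomial τ K)}

namespace IsRetract

lemma of_isMonomialIdeal (hJ' : J'.IsMonomialIdeal) (rename_mem : ∀ g ∈ J, rename i g ∈ J')
    (monomial_mem : ∀ b : σ →₀ ℕ, monomial (b.mapDomain i) (1 : K) ∈ J' →
      monomial b (1 : K) ∈ J) : IsRetract hi J J' := by
  refine ⟨rename_mem, ?_⟩
  obtain ⟨A, rfl⟩ := hJ'
  suffices h : Ideal.span ((fun a => monomial a (1 : K)) '' A) ≤ J.comap (killCompl hi) from h
  rw [Ideal.span_le]
  rintro _ ⟨a, ha, rfl⟩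
  rw [SetLike.mem_coe, Ideal.mem_comap]
  by_cases hai : (a.support : Set τ) ⊆ Set.range i
  · obtain ⟨b, rfl⟩ : ∃ b, Finsupp.mapDomain i b = a :=
      ⟨_, Finsupp.mapDomain_comapDomain i hi a hai⟩
    rw [killCompl_monomial_mapDomain]
    exact monomial_mem b (Ideal.subset_span ⟨_, ha, rfl⟩)
  · rw [killCompl_monomial_eq_zero_of_not_subset hi _ hai]
    exact J.zero_mem

lemma comap {υ : Type*} {j : τ → υ} {hj : Function.Injective j}
    {J' : Ideal (MvPolynomial υ K)} (h : IsRetract (hj.comp hi) J J') :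
    IsRetract hi J (J'.comap (rename j)) := by
  refine ⟨fun g hg => ?_, fun g hg => ?_⟩
  · rw [Ideal.mem_comap, rename_rename]
    exact h.rename_mem g hg
  · rw [← killCompl_comp_rename_eq_killCompl hi hj]
    exact h.killCompl_mem _ hg

variable [Fintype σ] [DecidableEq σ] [Fintype τ] [DecidableEq τ]

lemma hasKoszulHomology_of_surjective (h : IsRetract hi J J') (hs : Function.Surjective i)
    {p : ℕ} {d : ℤ} (hJ' : HasKoszulHomology τ (piece J') p d) :
    HasKoszulHomology σ (piece J) p d := by
  by_contra hJ
  obtain ⟨f, hf, hfd, hfb⟩ := hJ'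
  obtain ⟨b, hb, hbf⟩ := h.exists_koszulD_eq_extendChain hJ hf hfd
  refine hfb b hb (hbf.trans ?_)
  have rename_killCompl : (rename i).comp (killCompl hi) = AlgHom.id K (MvPolynomial τ K) := by
    refine MvPolynomial.algHom_ext fun t => ?_
    obtain ⟨s, rfl⟩ := hs t
    rw [AlgHom.comp_apply, killCompl_X, rename_X, AlgHom.id_apply]
  ext v : 1
  refine (DFunLike.congr_fun rename_killCompl _).trans (congrArg f (funext fun j => ?_))
  funext t
  obtain ⟨s, rfl⟩ := hs t
  exact hi.extend_apply _ _ _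

lemma eq_one_or_hasKoszulHomology_of_forall_X_mem (h : IsRetract hi J J')
    (hX : ∀ t ∉ Set.range i, X t ∈ J') {p : ℕ} {d : ℤ}
    (hJ' : HasKoszulHomology τ (piece J') p d) :
    d = 1 ∨ ∃ q, HasKoszulHomology σ (piece J) q d := by
  induction hn : Fintype.card τ generalizing τ p with
  | zero =>
    have := Fintype.card_eq_zero_iff.1 hn
    exact Or.inr ⟨p, h.hasKoszulHomology_of_surjective isEmptyElim hJ'⟩
  | succ n ih =>
    by_cases hs : Function.Surjective i
    · exact Or.inr ⟨p, h.hasKoszulHomology_of_surjective hs hJ'⟩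
    obtain ⟨y, hy⟩ : ∃ y, y ∉ Set.range i := by simpa [Function.Surjective] using hs
    let i₀ : σ → {t // t ≠ y} := fun s => ⟨i s, fun h => hy ⟨s, h⟩⟩
    have hi₀ : Function.Injective i₀ := fun a b hab => hi (congrArg Subtype.val hab)
    have hval : Function.Injective (Subtype.val : {t // t ≠ y} → τ) := Subtype.val_injective
    have range_val : Set.range (Subtype.val : {t // t ≠ y} → τ) = {y}ᶜ := by ext; simp
    obtain hd | ⟨q, hq⟩ := (isRetract_comap hval range_val (hX y hy)).eq_one_or_hasKoszulHomology
      range_val (hX y hy) hJ'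
    · exact Or.inl hd
    · refine ih (comap (hi := hi₀) (hj := hval) h) (fun t ht => ?_) hq (by simp [hn])
      rw [Ideal.mem_comap, rename_X]
      exact hX _ fun ⟨s, hs⟩ => ht ⟨s, Subtype.ext hs⟩

end IsRetract

end AdjoinVariables

section Regularity

variable {τ K : Type*} [Field K]

lemma exists_eq_natCast_of_piece_ne_bot {J : Ideal (MvPolynomial τ K)} {d : ℤ}
    (hd : piece J d ≠ ⊥) : ∃ n : ℕ, d = n := by
  obtain ⟨f, hf, f_ne⟩ := (Submodule.ne_bot_iff _).1 hd
  obtain ⟨m, hm⟩ := MvPolynomial.ne_zero_iff.1 f_ne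
  exact ⟨m.degree, ((mem_piece.1 hf).2 m hm).symm⟩

lemma eq_top_of_piece_zero_ne_bot {J : Ideal (MvPolynomial τ K)} (h : piece J 0 ≠ ⊥) : J = ⊤ := by
  obtain ⟨f, hf, f_ne⟩ := (Submodule.ne_bot_iff _).1 h
  obtain ⟨f_mem, f_degree⟩ := mem_piece.1 hf
  have f_const : f = C (coeff 0 f) := by
    refine totalDegree_eq_zero_iff_eq_C.1 (Nat.le_zero.1 (Finset.sup_le fun m hm => ?_))
    exact_mod_cast (f_degree m (mem_support_iff.1 hm)).le
  refine Ideal.eq_top_of_isUnit_mem _ f_mem ?_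
  rw [f_const] at f_ne ⊢
  exact (isUnit_iff_ne_zero.2 fun h => f_ne (by rw [h, C_0])).map C

lemma sSup_eq_sSup_of_isCofinalFor {S S' : Set ℤ} (hne : S.Nonempty) (h : S ⊆ S')
    (h' : IsCofinalFor S' S) : sSup S = sSup S' := by
  have upperBounds_eq : upperBounds S = upperBounds S' :=
    (upperBounds_mono_set h).antisymm' (upperBounds_mono_of_isCofinalFor h')
  by_cases hb : BddAbove S
  · have hb' : BddAbove S' := by rwa [BddAbove, ← upperBounds_eq]
    refine (isLUB_csSup hne hb).unique ?_
    rw [IsLUB, upperBounds_eq]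
    exact isLUB_csSup (hne.mono h) hb'
  · rw [Int.csSup_of_not_bddAbove hb, Int.csSup_of_not_bddAbove fun hb' => hb (hb'.mono h)]

lemma piece_degree_ne_bot {J : Ideal (MvPolynomial τ K)} {a : τ →₀ ℕ}
    (ha : monomial a (1 : K) ∈ J) : piece J a.degree ≠ ⊥ :=
  (Submodule.ne_bot_iff _).2
    ⟨_, mem_piece_iff_mem_piece_top.2 ⟨ha, monomial_mem_piece_top a 1⟩, by simp⟩

variable [Fintype τ] [DecidableEq τ]

lemma HasKoszulHomology.piece_ne_bot {J : Ideal (MvPolynomial τ K)} {p : ℕ} {d : ℤ}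
    (h : HasKoszulHomology τ (piece J) p d) : piece J d ≠ ⊥ := by
  obtain ⟨f, -, hfd, hfb⟩ := h
  refine fun hbot => hfb 0 (fun _ => Submodule.zero_mem _) ?_
  ext v : 1
  rw [map_zero]
  exact ((Submodule.mem_bot K).1 (hbot ▸ hfd v)).symm

lemma exists_hasKoszulHomology_zero {J : Ideal (MvPolynomial τ K)} {n : ℕ}
    (hn : piece J n ≠ ⊥) : ∃ d, HasKoszulHomology τ (piece J) 0 d := by
  classical
  have hex : ∃ n : ℕ, piece J n ≠ ⊥ := ⟨n, hn⟩
  obtain ⟨g, hg, g_ne⟩ := (Submodule.ne_bot_iff _).1 (Nat.find_spec hex)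
  have piece_pred : piece J (Nat.find hex - 1) = ⊥ := by
    by_contra hne
    obtain ⟨m, hm⟩ := exists_eq_natCast_of_piece_ne_bot hne
    exact Nat.find_min hex (m := m) (by omega) (hm ▸ hne)
  refine ⟨Nat.find hex, AlternatingMap.constOfIsEmpty K (τ → K) (Fin 0) g, trivial,
    fun _ => hg, fun k hk hkg => g_ne ?_⟩
  have k_zero : k = 0 := by
    ext v : 1
    exact (Submodule.mem_bot K).1 (piece_pred ▸ hk v)
  rw [k_zero, map_zero] at hkg
  exact (DFunLike.congr_fun hkg 0).symm

variable {σ : Type*} [Fintype σ] [DecidableEq σ] {i : σ → τ} {hi : Function.Injective i}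
  {J : Ideal (MvPolynomial σ K)} {J' : Ideal (MvPolynomial τ K)}

theorem IsRetract.reg_eq (h : IsRetract hi J J') (hX : ∀ t ∉ Set.range i, X t ∈ J') {n : ℕ}
    (hn : piece J n ≠ ⊥) : J'.reg = J.reg := by
  obtain ⟨d, hd⟩ := exists_hasKoszulHomology_zero hn
  rw [reg_eq_sSup, reg_eq_sSup]
  symm
  refine sSup_eq_sSup_of_isCofinalFor ⟨d, 0, hd⟩
    (fun x ⟨p, hx⟩ => ⟨p, h.hasKoszulHomology hx⟩) ?_
  rintro x ⟨p, hx⟩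
  obtain ⟨m, rfl⟩ := exists_eq_natCast_of_piece_ne_bot hd.piece_ne_bot
  obtain rfl | hm := Nat.eq_zero_or_pos m
  · have J'_top : J' = ⊤ := by
      rw [Ideal.eq_top_iff_one, ← map_one (rename i)]
      exact h.rename_mem 1 (eq_top_of_piece_zero_ne_bot hd.piece_ne_bot ▸ trivial)
    subst J'_top
    exact ⟨0, ⟨0, hd⟩, (eq_zero_of_hasKoszulHomology_top hx).2.le⟩
  · obtain rfl | hq := h.eq_one_or_hasKoszulHomology_of_forall_X_mem hX hx
    · exact ⟨m, ⟨0, hd⟩, by omega⟩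
    · exact ⟨x, hq, le_rfl⟩

end Regularity

end Koszul

section EventuallyLinear

open Filter

/-- The function agrees with an affine function for all large arguments. -/
def EventuallyLinear (f : ℕ+ → ℤ) : Prop :=
  ∃ C D : ℤ, ∀ᶠ n : ℕ+ in atTop, f n = C * (n : ℤ) + D

lemma eventually_add_one {P : ℕ+ → Prop} (h : ∀ᶠ n in atTop, P n) :
    ∀ᶠ n in atTop, P (n + 1) :=
  (tendsto_atTop_mono (fun n => (PNat.lt_add_right n 1).le) tendsto_id).eventually h

lemma eventually_linear_le_linear {C₁ D₁ C₂ D₂ : ℤ} (h : C₁ < C₂) :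
    ∀ᶠ n : ℕ+ in atTop, C₁ * (n : ℤ) + D₁ ≤ C₂ * (n : ℤ) + D₂ := by
  filter_upwards [eventually_ge_atTop (Nat.succPNat (D₁ - D₂).toNat)] with n hn
  have hn' : (D₁ - D₂).toNat + 1 ≤ (n : ℕ) := hn
  have hD : D₁ - D₂ ≤ (n : ℤ) := by omega
  nlinarith [n.pos]

lemma forall_ge_of_succ {N : ℕ+} {P : ℕ+ → Prop} (base : P N)
    (step : ∀ n, N ≤ n → P n → P (n + 1)) : ∀ n, N ≤ n → P n := fun _ hn =>
  Succ.rec base (fun n hn h => by simpa using step n hn h) hn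

namespace EventuallyLinear

variable {f g : ℕ+ → ℤ}

lemma congr (hf : EventuallyLinear f) (h : ∀ᶠ n in atTop, g n = f n) : EventuallyLinear g := by
  obtain ⟨C, D, hC⟩ := hf
  exact ⟨C, D, by filter_upwards [hC, h] with n h1 h2 using h2.trans h1⟩

lemma add_const (hf : EventuallyLinear f) (a : ℤ) : EventuallyLinear fun n => f n + a := by
  obtain ⟨C, D, hC⟩ := hf
  exact ⟨C, D + a, by filter_upwards [hC] with n h; rw [h, add_assoc]⟩

lemma max (hf : EventuallyLinear f) (hg : EventuallyLinear g) :
    EventuallyLinear fun n => max (f n) (g n) := by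
  obtain ⟨C₁, D₁, h₁⟩ := hf
  obtain ⟨C₂, D₂, h₂⟩ := hg
  rcases lt_trichotomy C₁ C₂ with h | rfl | h
  · refine ⟨C₂, D₂, ?_⟩
    filter_upwards [h₁, h₂, eventually_linear_le_linear h] with n e₁ e₂ hle
    rw [e₁, e₂, max_eq_right hle]
  · refine ⟨C₁, Max.max D₁ D₂, ?_⟩
    filter_upwards [h₁, h₂] with n e₁ e₂
    rw [e₁, e₂, max_add_add_left]
  · refine ⟨C₁, D₁, ?_⟩
    filter_upwards [h₁, h₂, eventually_linear_le_linear h] with n e₁ e₂ hle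
    rw [e₁, e₂, max_eq_left hle]

lemma of_add_one_eq {a : ℤ} (h : ∀ᶠ n in atTop, f (n + 1) = f n + a) : EventuallyLinear f := by
  obtain ⟨N, hN⟩ := eventually_atTop.1 h
  refine ⟨a, f N - a * N, eventually_atTop.2 ⟨N, forall_ge_of_succ (by ring) fun n hn ih => ?_⟩⟩
  rw [hN n hn, ih]
  push_cast
  ring

lemma of_add_one_eq_max_of_le {C D a : ℤ} (hCa : C ≤ a)
    (h : ∀ᶠ n : ℕ+ in atTop, f (n + 1) = Max.max (C * (n + 1) + D) (f n + a)) :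
    EventuallyLinear f := by
  have linear_le : ∀ᶠ n : ℕ+ in atTop, C * (n : ℤ) + D ≤ f n := by
    obtain ⟨N, hN⟩ := eventually_atTop.1 h
    refine eventually_atTop.2 ⟨N + 1, forall_ge_of_succ ?_ fun n hn _ => ?_⟩
    · simp [hN N le_rfl]
    · simp [hN n ((PNat.lt_add_right N 1).le.trans hn)]
  refine of_add_one_eq (a := a) ?_
  filter_upwards [h, linear_le] with n hn hle
  rw [hn, max_eq_right]
  linarith

lemma of_add_one_eq_max_of_lt {C D a : ℤ} (haC : a < C)
    (h : ∀ᶠ n : ℕ+ in atTop, f (n + 1) = Max.max (C * (n + 1) + D) (f n + a)) :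
    EventuallyLinear f := by
  obtain ⟨N, hN⟩ := eventually_atTop.1 h
  by_cases translate : ∀ n ≥ N, C * ((n : ℤ) + 1) + D ≤ f n + a
  · exact of_add_one_eq (eventually_atTop.2
      ⟨N, fun n hn => by rw [hN n hn, max_eq_right (translate n hn)]⟩)
  push Not at translate
  obtain ⟨m, hm, hlt⟩ := translate
  refine ⟨C, D, eventually_atTop.2 ⟨m + 1, forall_ge_of_succ ?_ fun n hn ih => ?_⟩⟩
  · simp [hN m hm, hlt.le]
  · rw [hN n (hm.trans ((PNat.lt_add_right m 1).le.trans hn)), max_eq_left]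
    · push_cast
      rfl
    · linarith

lemma of_add_one_eq_max {L : ℕ+ → ℤ} {a : ℤ} (hL : EventuallyLinear L)
    (h : ∀ᶠ n in atTop, f (n + 1) = Max.max (L (n + 1)) (f n + a)) : EventuallyLinear f := by
  obtain ⟨C, D, hC⟩ := hL
  have recurrence :
      ∀ᶠ n : ℕ+ in atTop, f (n + 1) = Max.max (C * (n + 1) + D) (f n + a) := by
    filter_upwards [h, eventually_add_one hC] with n hn hLn
    rw [hn, hLn]
    push_cast
    rfl
  obtain hCa | haC := le_or_gt C a
  · exact of_add_one_eq_max_of_le hCa recurrence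
  · exact of_add_one_eq_max_of_lt haC recurrence

end EventuallyLinear

section IsGreatest

variable {ι : Type*} {s : Set ι} {f : ℕ+ → ℤ} {g : ι → ℕ+ → ℤ}

lemma exists_eventuallyLinear_isGreatest (hs : s.Finite) (hne : s.Nonempty)
    (h : ∀ i ∈ s, EventuallyLinear (g i)) :
    ∃ L, EventuallyLinear L ∧ ∀ n, IsGreatest ((fun i => g i n) '' s) (L n) := by
  induction s, hs using Set.Finite.induction_on with
  | empty => exact absurd hne Set.not_nonempty_empty
  | @insert i t _ _ ih =>
    have hi := h i (t.mem_insert i)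
    obtain rfl | ht := t.eq_empty_or_nonempty
    · exact ⟨g i, hi, fun n => by simp⟩
    · obtain ⟨L, hL, greatest⟩ := ih ht fun j hj => h j (t.mem_insert_of_mem i hj)
      exact ⟨_, hi.max hL, fun n => Set.image_insert_eq ▸ (greatest n).insert (g i n)⟩

lemma exists_eventually_isGreatest_add (hs : s.Finite) (hne : s.Nonempty)
    (h : ∀ i ∈ s, ∃ a, ∀ᶠ n in atTop, g i (n + 1) = f n + a) :
    ∃ a, ∀ᶠ n in atTop, IsGreatest ((fun i => g i (n + 1)) '' s) (f n + a) := by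
  choose! a ha using h
  obtain ⟨j, hj, hmax⟩ := Set.exists_max_image s a hs hne
  refine ⟨a j, ?_⟩
  filter_upwards [(eventually_all_finite hs).2 ha] with n hn
  refine ⟨⟨j, hj, hn j hj⟩, ?_⟩
  rintro _ ⟨i, hi, rfl⟩
  linarith [hn i hi, hmax i hi]

theorem EventuallyLinear.of_isGreatest (hs : s.Finite)
    (hf : ∀ᶠ n in atTop, IsGreatest ((fun i => g i n) '' s) (f n))
    (hg : ∀ i ∈ s, EventuallyLinear (g i) ∨ ∃ a, ∀ᶠ n in atTop, g i (n + 1) = f n + a) :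
    EventuallyLinear f := by
  let A := {i ∈ s | EventuallyLinear (g i)}
  let B := {i ∈ s | ∃ a, ∀ᶠ n in atTop, g i (n + 1) = f n + a}
  have hA : A.Finite := hs.sep _
  have hB : B.Finite := hs.sep _
  have s_eq : s = A ∪ B := Set.ext fun i =>
    ⟨fun hi => (hg i hi).imp (And.intro hi) (And.intro hi), fun hi => hi.elim And.left And.left⟩
  rw [s_eq] at hf
  have hf' := eventually_add_one hf
  simp only [Set.image_union] at hf hf'
  obtain A_empty | A_nonempty := A.eq_empty_or_nonempty
  · have B_nonempty : B.Nonempty := by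
      obtain ⟨n, hn⟩ := hf.exists
      simpa [A_empty] using hn.nonempty
    obtain ⟨a, ha⟩ := exists_eventually_isGreatest_add hB B_nonempty fun i hi => hi.2
    refine .of_add_one_eq (a := a) ?_
    filter_upwards [hf', ha] with n hn hBn
    rw [A_empty, Set.image_empty, Set.empty_union] at hn
    exact hn.unique hBn
  obtain ⟨L, hL, hLA⟩ := exists_eventuallyLinear_isGreatest hA A_nonempty fun i hi => hi.2
  obtain B_empty | B_nonempty := B.eq_empty_or_nonempty
  · refine hL.congr ?_
    filter_upwards [hf] with n hn
    rw [B_empty, Set.image_empty, Set.union_empty] at hn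
    exact hn.unique (hLA n)
  · obtain ⟨a, ha⟩ := exists_eventually_isGreatest_add hB B_nonempty fun i hi => hi.2
    refine .of_add_one_eq_max hL (a := a) ?_
    filter_upwards [hf', ha] with n hn hBn
    exact hn.unique ((hLA _).union hBn)

end IsGreatest

end EventuallyLinear

section WellQuasiOrder

open Filter

lemma wellFounded_eventually_le {α : Type*} [Preorder α] [WellQuasiOrderedLE α] (l : Filter α) :
    WellFounded fun B A : UpperSet α =>
      (∀ᶠ w in l, w ∈ A → w ∈ B) ∧ ¬ ∀ᶠ w in l, w ∈ B → w ∈ A := by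
  rw [wellFounded_iff_isEmpty_descending_chain]
  refine ⟨fun ⟨A, hA⟩ => ?_⟩
  have eventually_ascends (n : ℕ) : ∀ᶠ w in l, ∀ j ≤ n, w ∈ A j → w ∈ A (j + 1) :=
    (eventually_all_finite (Set.finite_Iic n)).2 fun j _ => (hA j).1
  have exists_new (n : ℕ) : ∃ w ∈ A (n + 1), w ∉ A n ∧ ∀ j ≤ n, w ∈ A j → w ∈ A (j + 1) := by
    obtain ⟨w, hw, ascends⟩ :=
      ((not_eventually.1 (hA n).2).and_eventually (eventually_ascends n)).exists
    push Not at hw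
    exact ⟨w, hw.1, hw.2, ascends⟩
  choose w mem_succ notMem ascends using exists_new
  obtain ⟨a, b, hab, hle⟩ := wellQuasiOrdered_le w
  have mem_of_le (j : ℕ) (hj : a + 1 ≤ j) : j ≤ b → w b ∈ A j := by
    induction j, hj using Nat.le_induction with
    | base => exact fun _ => (A (a + 1)).upper hle (mem_succ a)
    | succ j _ ih => exact fun hjb => ascends b j (by omega) (ih (by omega))
  exact notMem b (mem_of_le b hab le_rfl)

lemma finite_of_bddAbove_add_strictMono {α β : Type*} [PartialOrder α] [WellQuasiOrderedLE α]
    [PartialOrder β] [WellFoundedGT β] {F : α → β} (hF : Monotone F) {r : β → ℤ} {w : α → ℤ}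
    (hw : StrictMono w) {E : Set α} (h : BddAbove ((fun e => r (F e) + w e) '' E)) :
    E.Finite := by
  refine Set.not_infinite.1 fun hE => ?_
  let u : ℕ → α := fun m => hE.natEmbedding E m
  have hu : Function.Injective u :=
    Subtype.val_injective.comp (hE.natEmbedding E).injective
  obtain ⟨g, hg⟩ := (wellQuasiOrdered_le (α := α)).exists_monotone_subseq u
  have u_strictMono : StrictMono (u ∘ g) :=
    Monotone.strictMono_of_injective (fun a b => hg a b) (hu.comp g.injective)
  obtain ⟨M, hM⟩ := WellFoundedGT.monotone_chain_condition
    ⟨F ∘ u ∘ g, hF.comp u_strictMono.monotone⟩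
  have tail_strictMono : StrictMono fun m => w (u (g (M + m))) :=
    hw.comp (u_strictMono.comp (strictMono_id.const_add M))
  refine tail_strictMono.not_bddAbove_range_of_isSuccArchimedean ?_
  obtain ⟨b, hb⟩ := h
  refine ⟨b - r (F (u (g M))), ?_⟩
  rintro _ ⟨m, rfl⟩
  have F_eq : F (u (g M)) = F (u (g (M + m))) := hM (M + m) (Nat.le_add_right M m)
  rw [F_eq]
  exact le_sub_iff_add_le'.2 (hb ⟨u (g (M + m)), (hE.natEmbedding E _).2, rfl⟩)

end WellQuasiOrder

namespace IncChain

section Words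

variable {c i : ℕ}

/-- The columns of the exponent vector of a monomial, the first `i` of which are fixed by
`Inc(ℕ)^i` and therefore kept apart from the list of the others. -/
structure Word (c i : ℕ) where
  head : Fin i → Fin c → ℕ
  tail : List (Fin c → ℕ)

namespace Word

/-- Divisibility of monomials up to the action of `Inc(ℕ)^i`: the heads are compared columnwise,
and the tails as in Higman's lemma. -/
instance : Preorder (Word c i) where
  le w w' := w.head ≤ w'.head ∧ List.SublistForall₂ (· ≤ ·) w.tail w'.tail
  le_refl w := ⟨le_rfl, refl w.tail⟩
  le_trans _ _ _ h h' := ⟨h.1.trans h'.1, _root_.trans h.2 h'.2⟩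

instance : WellQuasiOrderedLE (Word c i) where
  wqo f := by
    have tail_wqo :
        WellQuasiOrdered (List.SublistForall₂ ((· ≤ ·) : (Fin c → ℕ) → (Fin c → ℕ) → Prop)) := by
      rw [← Set.partiallyWellOrderedOn_univ_iff]
      exact (Set.PartiallyWellOrderedOn.partiallyWellOrderedOn_sublistForall₂ (· ≤ ·)
        (Set.isPWO_of_wellQuasiOrderedLE Set.univ)).mono fun _ _ _ _ => Set.mem_univ _
    exact (wellQuasiOrdered_le.prod tail_wqo) fun n => ((f n).head, (f n).tail)

/-- The columns of the monomial `(a, 0^k, l)` obtained from the word `(a, l)` by inserting `k`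
zero columns after its head. -/
def col (k : ℕ) (w : Word c i) (j : ℕ) : Fin c → ℕ :=
  if h : j < i then w.head ⟨j, h⟩ else if j < i + k then 0 else w.tail.getD (j - (i + k)) 0

/-- The exponent vector of the monomial `(a, 0^k, l)`, for a word `(a, l)` with
`i + k + l.length = n`. -/
noncomputable def exponent (k n : ℕ) (w : Word c i) : Fin c × Fin n →₀ ℕ :=
  Finsupp.equivFunOnFinite.symm fun x => w.col k x.2 x.1

@[simp]
lemma exponent_apply (k n : ℕ) (w : Word c i) (x : Fin c × Fin n) :
    w.exponent k n x = w.col k x.2 x.1 := rfl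

lemma exists_eq_exponent {k n : ℕ} (hn : i + k ≤ n) {b : Fin c × Fin n →₀ ℕ}
    (hb : ∀ x : Fin c × Fin n, i ≤ x.2 → (x.2 : ℕ) < i + k → b x = 0) :
    ∃ w : Word c i, i + k + w.tail.length = n ∧ b = w.exponent k n := by
  refine ⟨⟨fun j t => b (t, ⟨j, by omega⟩),
    List.ofFn fun (j : Fin (n - (i + k))) t => b (t, ⟨i + k + j, by omega⟩)⟩,
    by simp [hn], Finsupp.ext fun x => ?_⟩
  rw [exponent_apply, col]
  split_ifs with in_head in_gap
  · rfl
  · exact hb x (not_lt.1 in_head) in_gap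
  · rw [List.getD_eq_getElem _ _ (by simp; omega)]
    simp only [List.getElem_ofFn, Nat.add_sub_cancel' (not_lt.1 in_gap)]

end Word

/-- The map acting as `f` on the columns after the first `k`, and fixing these. -/
def shiftFrom (k : ℕ) (f : ℕ → ℕ) (j : ℕ) : ℕ := if j < k then j else k + f (j - k)

lemma shiftFrom_mem_Inc (k : ℕ) {f : ℕ → ℕ} (hf : StrictMono f) : shiftFrom k f ∈ Inc k := by
  refine ⟨fun a b hab => ?_, fun j hj => if_pos hj⟩
  simp only [shiftFrom]
  split_ifs
  · exact hab
  · omega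
  · omega
  · have := hf (show a - k < b - k by omega)
    omega

lemma shiftFrom_lt {k m n : ℕ} {f : ℕ → ℕ} (hkn : k ≤ n) (hf : ∀ j, k + j < m → k + f j < n)
    {j : ℕ} (hj : j < m) : shiftFrom k f j < n := by
  rw [shiftFrom]
  split_ifs
  · omega
  · exact hf _ (by omega)

/-- The element of `Inc(ℕ)^i` whose image misses only the column `i`. -/
abbrev skip (i : ℕ) : ℕ → ℕ := shiftFrom i Nat.succ

lemma skip_mem_Inc (i : ℕ) : skip i ∈ Inc i := shiftFrom_mem_Inc i fun _ _ => Nat.succ_lt_succ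

lemma skip_lt (i : ℕ) {j n : ℕ} (hj : j < n) : skip i j < n + 1 := by
  rw [skip, shiftFrom]
  split_ifs <;> omega

namespace Word

lemma col_le_col_shiftFrom {w w' : Word c i} (hhead : w.head ≤ w'.head) {f : ℕ → ℕ}
    (htail : ∀ j, w.tail.getD j 0 ≤ w'.tail.getD (f j) 0) (k j : ℕ) :
    w.col k j ≤ w'.col k (shiftFrom (i + k) f j) := by
  rw [col, shiftFrom]
  split_ifs with in_head
  · rw [col, dif_pos in_head]
    exact hhead _
  · omega
  · exact bot_le
  · rw [col, dif_neg (by omega), if_neg (by omega), Nat.add_sub_cancel_left]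
    exact htail _

lemma col_skip (w : Word c i) (k j : ℕ) :
    w.col (k + 1) (skip (i + k) j) = w.col k j := by
  simp only [col, skip, shiftFrom]
  by_cases in_head : j < i
  · simp only [in_head, show j < i + k by omega, if_true, dif_pos]
  by_cases in_gap : j < i + k
  · simp only [in_head, in_gap, show j < i + (k + 1) by omega, if_true, dif_neg, not_false_iff]
  · simp only [in_gap, in_head, if_false, dif_neg, not_false_iff]
    rw [dif_neg (by omega), if_neg (by omega)]
    congr 1
    omega

end Word

lemma exists_strictMono_of_sublistForall₂ {α : Type*} [Preorder α] (d : α) {l l' : List α}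
    (h : List.SublistForall₂ (· ≤ ·) l l') :
    ∃ f : ℕ → ℕ, StrictMono f ∧ (∀ j, j < l.length → f j < l'.length) ∧
      ∀ j, l.getD j d ≤ l'.getD (f j) d := by
  obtain ⟨m, hm, hml⟩ := List.sublistForall₂_iff.1 h
  obtain ⟨f, hf⟩ := List.sublist_iff_exists_orderEmbedding_getElem?_eq.1 hml
  obtain ⟨hlen, hget⟩ := List.forall₂_iff_get.1 hm
  refine ⟨f, f.strictMono, fun j hj => ?_, fun j => ?_⟩
  · have hfj := hf j
    rw [List.getElem?_eq_getElem (hlen ▸ hj)] at hfj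
    exact (List.getElem?_eq_some_iff.1 hfj.symm).1
  · rw [List.getD_eq_getElem?_getD, List.getD_eq_getElem?_getD, ← hf j]
    by_cases hj : j < l.length
    · rw [List.getElem?_eq_getElem hj, List.getElem?_eq_getElem (hlen ▸ hj)]
      exact hget j hj (hlen ▸ hj)
    · rw [List.getElem?_eq_none (by omega), List.getElem?_eq_none (by omega)]

end Words

variable {K : Type*} [Field K] {c : ℕ}

section Chains

open Filter

variable {i k : ℕ} {I : Chain K c}

/-- The map of variables `x_{k,j} ↦ x_{k,π(j)}`. -/
abbrev colMap {m n : ℕ} (π : ℕ → ℕ) (h : ∀ j : Fin m, π j < n) (x : Fin c × Fin m) :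
    Fin c × Fin n :=
  (x.1, ⟨π x.2, h x.2⟩)

lemma colMap_injective {m n : ℕ} {π : ℕ → ℕ} (hπ : Function.Injective π)
    (h : ∀ j : Fin m, π j < n) : Function.Injective (colMap (c := c) π h) := fun x y hxy => by
  simp only [colMap, Prod.mk.injEq, Fin.mk.injEq] at hxy
  exact Prod.ext hxy.1 (Fin.ext (hπ hxy.2))

lemma IsInvariant.act_mem (hI : IsInvariant i I) {m n : ℕ+} {π : ℕ → ℕ} (hπ : π ∈ Inc i)
    (h : ∀ j : Fin m, π j < n) {f : PolyRing K c m} (hf : f ∈ I m) : act π h f ∈ I n := by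
  have hmn : (m : ℕ) ≤ n := by
    have lt : π (m - 1) < n := h ⟨m - 1, Nat.sub_one_lt m.ne_zero⟩
    have le : (m : ℕ) - 1 ≤ π (m - 1) := hπ.1.le_apply
    have := m.pos
    omega
  exact hI m n hmn ⟨π, hπ, h, f, hf, rfl⟩

lemma IsInvariant.monomial_mem (hI : IsInvariant i I) {m n : ℕ+} {π : ℕ → ℕ} (hπ : π ∈ Inc i)
    (h : ∀ j : Fin m, π j < n) {a : Fin c × Fin m →₀ ℕ} {b : Fin c × Fin n →₀ ℕ}
    (ha : monomial a (1 : K) ∈ I m) (hab : ∀ x, a x ≤ b (colMap π h x)) :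
    monomial b (1 : K) ∈ I n := by
  have act_mem : act π h (monomial a (1 : K)) ∈ I n := hI.act_mem hπ h ha
  rw [act, rename_monomial] at act_mem
  refine (I n).mem_of_dvd (monomial_dvd_monomial.2 ⟨Or.inr fun y => ?_, dvd_rfl⟩) act_mem
  by_cases hy : y ∈ Set.range (colMap π h)
  · obtain ⟨x, rfl⟩ := hy
    rw [Finsupp.mapDomain_apply (colMap_injective hπ.1.injective h)]
    exact hab x
  · rw [Finsupp.mapDomain_of_notMem_range _ _ hy]
    exact Nat.zero_le _

/-- The words `(a, l)` such that the monomial `(a, 0^k, l)` belongs to the chain `I`. -/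
def words (i k : ℕ) (I : Chain K c) : Set (Word c i) :=
  {w | ∃ n : ℕ+, (n : ℕ) = i + k + w.tail.length ∧ monomial (w.exponent k n) (1 : K) ∈ I n}

lemma mem_words_iff {w : Word c i} {n : ℕ+} (hn : i + k + w.tail.length = n) :
    w ∈ words i k I ↔ monomial (w.exponent k n) (1 : K) ∈ I n := by
  refine ⟨fun ⟨m, hm, hw⟩ => ?_, fun hw => ⟨n, hn.symm, hw⟩⟩
  obtain rfl : m = n := PNat.eq (hm.trans hn)
  exact hw

lemma IsInvariant.isUpperSet_words (hI : IsInvariant (i + k) I) : IsUpperSet (words i k I) := by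
  rintro w w' ⟨head_le, tail_le⟩ ⟨n, hn, hw⟩
  obtain ⟨f, hf, f_lt, getD_le⟩ := exists_strictMono_of_sublistForall₂ 0 tail_le
  have length_le : w.tail.length ≤ w'.tail.length := by
    obtain ⟨l, hl, l_sublist⟩ := List.sublistForall₂_iff.1 tail_le
    exact hl.length_eq.trans_le l_sublist.length_le
  have hn_pos := n.pos
  let n' : ℕ+ := ⟨i + k + w'.tail.length, by omega⟩
  have shift_lt (j : Fin n) : shiftFrom (i + k) f j < n' :=
    shiftFrom_lt (Nat.le_add_right _ _)
      (fun j hj => Nat.add_lt_add_left (f_lt j (by omega)) _) j.2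
  exact (mem_words_iff (n := n') rfl).2 (hI.monomial_mem (shiftFrom_mem_Inc _ hf) shift_lt hw
    fun x => Word.col_le_col_shiftFrom head_le getD_le k x.2 x.1)

/-- The map of variables induced by `skip i`. -/
abbrev skipCol (i : ℕ) (n : ℕ+) : Fin c × Fin n → Fin c × Fin (n + 1 : ℕ+) :=
  colMap (skip i) fun j => skip_lt i j.2

lemma skipCol_injective (i : ℕ) (n : ℕ+) : Function.Injective (skipCol (c := c) i n) :=
  colMap_injective (skip_mem_Inc i).1.injective _

lemma val_eq_of_notMem_range_skipCol {n : ℕ+} (hi : i ≤ n) {t : Fin c × Fin (n + 1 : ℕ+)}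
    (ht : t ∉ Set.range (skipCol i n)) : (t.2 : ℕ) = i := by
  by_contra hne
  have ht2 : (t.2 : ℕ) < n + 1 := t.2.2
  refine ht ⟨(t.1, ⟨if (t.2 : ℕ) < i then t.2 else t.2 - 1, by split_ifs <;> omega⟩),
    Prod.ext rfl (Fin.ext ?_)⟩
  simp only [skip, shiftFrom]
  split_ifs <;> omega

lemma mapDomain_skipCol_exponent {n : ℕ+} (hn : i + k ≤ n) (w : Word c i) :
    (w.exponent k n).mapDomain (skipCol (i + k) n) = w.exponent (k + 1) (n + 1 : ℕ+) := by
  ext x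
  by_cases hx : x ∈ Set.range (skipCol (i + k) n)
  · obtain ⟨x, rfl⟩ := hx
    rw [Finsupp.mapDomain_apply (skipCol_injective (i + k) n), Word.exponent_apply,
      Word.exponent_apply, Word.col_skip]
  · rw [Finsupp.mapDomain_of_notMem_range _ _ hx, Word.exponent_apply,
      val_eq_of_notMem_range_skipCol hn hx, Word.col, dif_neg (by omega), if_pos (by omega)]
    rfl

lemma colonChain_eq {n : ℕ+} (h : ind i I < n ∧ i < n) (e : Fin c → ℕ) :
    colonChain i I e n = (I n).colon {∏ k : Fin c, X (k, ⟨i, h.2⟩) ^ e k} ⊔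
      Ideal.span (Set.range fun k : Fin c => X (k, ⟨i, h.2⟩)) :=
  dif_pos h

lemma le_colonChain {n : ℕ+} (h : ind i I < n ∧ i < n) (e : Fin c → ℕ) :
    I n ≤ colonChain i I e n := by
  rw [colonChain_eq h]
  exact Ideal.le_colon.trans le_sup_left

lemma X_mem_colonChain {n : ℕ+} (h : ind i I < n ∧ i < n) (e : Fin c → ℕ)
    {t : Fin c × Fin n} (ht : (t.2 : ℕ) = i) : X t ∈ colonChain i I e n := by
  rw [colonChain_eq h]
  exact Ideal.mem_sup_right (Ideal.subset_span ⟨t.1, by simp [← ht]⟩)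

lemma colonChain_mono (i : ℕ) (I : Chain K c) (n : ℕ+) :
    Monotone fun e => colonChain i I e n := fun e e' h => by
  by_cases hn : ind i I < n ∧ i < n
  · simp only [colonChain_eq hn]
    refine sup_le_sup_right (fun f hf => ?_) _
    rw [Submodule.mem_colon_singleton] at hf ⊢
    exact (I n).mem_of_dvd
      (mul_dvd_mul_left f (Finset.prod_dvd_prod_of_dvd _ _ fun k _ => pow_dvd_pow _ (h k))) hf
  · simp only [colonChain, dif_neg hn, le_refl]

lemma eventually_exists_monomial_mem (h : (i, I) ∈ family K c) :
    ∀ᶠ n in atTop, ∃ a, monomial a (1 : K) ∈ I n := by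
  obtain ⟨⟨m, hm⟩, monomial_ideal, invariant⟩ := h
  obtain ⟨A, hA : I m = _⟩ := monomial_ideal m
  obtain ⟨a, ha⟩ : A.Nonempty := by
    rw [Set.nonempty_iff_ne_empty]
    rintro rfl
    exact hm (by simpa using hA)
  have ha_mem : monomial a (1 : K) ∈ I m := hA ▸ Ideal.subset_span ⟨a, ha, rfl⟩
  filter_upwards [eventually_ge_atTop m] with n hn
  have act_mem := IsInvariant.act_mem invariant (π := id) (n := n)
    ⟨strictMono_id, fun _ _ => rfl⟩ (fun j => j.2.trans_le hn) ha_mem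
  rw [act, rename_monomial] at act_mem
  exact ⟨_, act_mem⟩

/-- The variables in the columns `i, …, i + k - 1` eventually belong to the ideals of the chain:
after `k` passages to `colonChain`, these columns are irrelevant. -/
def ContainsColumns (i k : ℕ) (I : Chain K c) : Prop :=
  ∀ᶠ n : ℕ+ in atTop, ∀ x : Fin c × Fin n, i ≤ x.2 → (x.2 : ℕ) < i + k → X x ∈ I n

lemma ContainsColumns.colonChain (h : ContainsColumns i k I) (e : Fin c → ℕ) :
    ContainsColumns i (k + 1) (colonChain (i + k) I e) := by
  filter_upwards [h, tendsto_PNat_val_atTop_atTop.eventually_gt_atTop (ind (i + k) I),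
    tendsto_PNat_val_atTop_atTop.eventually_gt_atTop (i + k)] with n hn ind_lt lt x hx hxk
  by_cases hk : (x.2 : ℕ) < i + k
  · exact le_colonChain ⟨ind_lt, lt⟩ e (hn x hx hk)
  · exact X_mem_colonChain ⟨ind_lt, lt⟩ e (by omega)

/-- The filter of the words whose tail is long enough. -/
def longWords (c i : ℕ) : Filter (Word c i) := comap (fun w => w.tail.length) atTop

lemma eventually_longWords_length_ge (c i N : ℕ) :
    ∀ᶠ w in longWords c i, N ≤ w.tail.length :=
  tendsto_comap.eventually_ge_atTop N

lemma eventually_mem_words_colonChain (hI : IsInvariant (i + k) I) (e : Fin c → ℕ) :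
    ∀ᶠ w in longWords c i, w ∈ words i k I → w ∈ words i (k + 1) (colonChain (i + k) I e) := by
  filter_upwards [eventually_longWords_length_ge c i (ind (i + k) I)]
    with w length_ge ⟨n, hn, hw⟩
  have hn' : ((n + 1 : ℕ+) : ℕ) = n + 1 := rfl
  refine (mem_words_iff (n := n + 1) (by omega)).2 (le_colonChain ⟨by omega, by omega⟩ e ?_)
  exact hI.monomial_mem (n := n + 1) (skip_mem_Inc (i + k)) (fun j => skip_lt (i + k) j.2) hw
    fun x => (congrFun (w.col_skip k x.2) x.1).ge

lemma eventually_isRetract_colonChain (hI : IsInvariant (i + k) I) (hcol : ContainsColumns i k I)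
    {e : Fin c → ℕ} (he : ∀ n, (colonChain (i + k) I e n).IsMonomialIdeal)
    (hwords : ∀ᶠ w in longWords c i,
      w ∈ words i (k + 1) (colonChain (i + k) I e) → w ∈ words i k I) :
    ∀ᶠ n in atTop, Koszul.IsRetract (skipCol_injective (i + k) n) (I n)
      (colonChain (i + k) I e (n + 1)) := by
  obtain ⟨N, hN⟩ := eventually_atTop.1 (eventually_comap.1 hwords)
  filter_upwards [hcol, tendsto_PNat_val_atTop_atTop.eventually_gt_atTop (ind (i + k) I),
    tendsto_PNat_val_atTop_atTop.eventually_gt_atTop (i + k + N)] with n X_mem ind_lt lt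
  have hn' : ((n + 1 : ℕ+) : ℕ) = n + 1 := rfl
  refine .of_isMonomialIdeal (he (n + 1)) (fun g hg => ?_) fun b hb => ?_
  · exact le_colonChain ⟨by omega, by omega⟩ e
      (hI.act_mem (n := n + 1) (skip_mem_Inc (i + k)) (fun j => skip_lt (i + k) j.2) hg)
  by_cases b_zero : ∀ x : Fin c × Fin n, i ≤ x.2 → (x.2 : ℕ) < i + k → b x = 0
  · obtain ⟨w, hw, rfl⟩ := Word.exists_eq_exponent (k := k) (by omega) b_zero
    rw [mapDomain_skipCol_exponent (by omega), ← mem_words_iff (by omega)] at hb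
    exact (mem_words_iff hw).1 (hN _ (by omega) w rfl hb)
  · push Not at b_zero
    obtain ⟨x, le_x, x_lt, hbx⟩ := b_zero
    exact (I n).mem_of_dvd (X_dvd_monomial.2 (Or.inr hbx)) (X_mem x le_x x_lt)

lemma eventually_reg_colonChain_eq (hI : (i + k, I) ∈ family K c) (hcol : ContainsColumns i k I)
    {e : Fin c → ℕ} (he : ∀ n, (colonChain (i + k) I e n).IsMonomialIdeal)
    (hwords : ∀ᶠ w in longWords c i,
      w ∈ words i (k + 1) (colonChain (i + k) I e) → w ∈ words i k I) :
    ∀ᶠ n in atTop, (colonChain (i + k) I e (n + 1)).reg = (I n).reg := by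
  filter_upwards [eventually_isRetract_colonChain hI.2.2 hcol he hwords,
    eventually_exists_monomial_mem hI,
    tendsto_PNat_val_atTop_atTop.eventually_gt_atTop (ind (i + k) I),
    tendsto_PNat_val_atTop_atTop.eventually_gt_atTop (i + k)] with n retract ⟨a, ha⟩ ind_lt lt
  have hn' : ((n + 1 : ℕ+) : ℕ) = n + 1 := rfl
  refine retract.reg_eq (fun t ht => ?_) (Koszul.piece_degree_ne_bot ha)
  exact X_mem_colonChain ⟨by omega, by omega⟩ e (val_eq_of_notMem_range_skipCol lt.le ht)

lemma finite_of_isGreatest_reg_colonChain {n : ℕ+} {E : Set (Fin c → ℕ)} {b : ℤ}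
    (h : IsGreatest ((fun e => (colonChain i I e n).reg + ∑ k, (e k : ℤ)) '' E) b) :
    E.Finite := by
  refine finite_of_bddAbove_add_strictMono (colonChain_mono i I n)
    (r := fun J => J.reg) (w := fun e => ∑ k, (e k : ℤ)) ?_ ⟨b, h.2⟩
  intro e e' h
  beta_reduce
  exact_mod_cast show ∑ k, e k < ∑ k, e' k from Fintype.sum_strictMono h

end Chains

theorem eventuallyLinear_reg {𝓔 : Set (ℕ × Chain K c)} (h𝓔 : IsExtremal 𝓔) {i k : ℕ}
    {I : Chain K c} (hI : (i + k, I) ∈ 𝓔) (hcol : ContainsColumns i k I) :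
    EventuallyLinear fun n => (I n).reg := by
  have isUpperSet_words {k : ℕ} {I : Chain K c} (hI : (i + k, I) ∈ 𝓔) :
      IsUpperSet (words i k I) := IsInvariant.isUpperSet_words (h𝓔.1 hI).2.2
  induction hU : (⟨words i k I, isUpperSet_words hI⟩ : UpperSet (Word c i)) using
    (wellFounded_eventually_le (longWords c i)).induction generalizing k I with
  | _ U ih =>
  subst hU
  obtain ⟨E, hE, hmax⟩ := h𝓔.2 _ _ hI
  obtain ⟨n, hn⟩ := hmax.exists
  refine .of_isGreatest (finite_of_isGreatest_reg_colonChain hn) hmax fun e he => ?_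
  by_cases stationary : ∀ᶠ w in longWords c i,
      w ∈ words i (k + 1) (colonChain (i + k) I e) → w ∈ words i k I
  · refine Or.inr ⟨∑ t, (e t : ℤ), ?_⟩
    filter_upwards [eventually_reg_colonChain_eq (h𝓔.1 hI) hcol (h𝓔.1 (hE e he)).2.1 stationary]
      with n hn
    rw [hn]
  · exact Or.inl ((ih _ ⟨eventually_mem_words_colonChain (h𝓔.1 hI).2.2 e, stationary⟩
      (hE e he) (hcol.colonChain e) rfl).add_const _)

end IncChain

theorem mainTheorem4 {K : Type*} [Field K] {c : ℕ} (hc : 0 < c)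
    (𝓔 : Set (ℕ × IncChain.Chain K c)) (h𝓔 : IncChain.IsExtremal 𝓔)
    (i : ℕ) (I : IncChain.Chain K c) (hI : (i, I) ∈ 𝓔) :
    ∃ C D : ℤ, ∀ᶠ n : ℕ+ in Filter.atTop, (I n).reg = C * (n : ℤ) + D := by
  have containsColumns_zero : IncChain.ContainsColumns i 0 I :=
    Filter.Eventually.of_forall fun n x le lt => absurd lt le.not_gt
  exact IncChain.eventuallyLinear_reg (k := 0) h𝓔 hI containsColumns_zero
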